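/- Let $c\ge 0$, let $\mathbb H_c=L^2(\mathbb R,e^{-2ct}\,dt)$ (complex-valued functions), and let $\partial_c f=f'$ be the differentiation operator on $\mathbb H_c$ with domain $D(\partial_c)=\{f\in\mathbb H_c: f \text{ locally absolutely continuous on }\mathbb R,\ f'\in\mathbb H_c\}$. Put $V_c=(\partial_c-c)/i$, a self-adjoint operator on $\mathbb H_c$, so that $\partial_c=c+iV_c$. For every $T>0$ let $\phi^{(T)}:\mathbb R\to\mathbb R$ be any $T$-admissible cut-off function, that is, a continuous function such that the closure of $\phi^{(T)}(\mathbb R)$ is $[-T,T]$ and, if $c=1$, such that $\phi^{(T)}$ is moreover the restriction to $\mathbb R$ of a meromorphic function on an open neighborhood of $\mathbb R$ in $\mathbb C$. Using the measurable functional calculus for (possibly unbounded) normal operators, define the truncated operators $$\partial_c^{(T)}=c+i\,\phi^{(T)}(V_c),\qquad \mathfrak a_c^{(T)}=\zeta\big(\partial_c^{(T)}\big),$$ where $\zeta$ is the Riemann zeta function. (For $c=1$ the value assigned to $\zeta$ at its pole $s=1$ is irrelevant, since $1$ is not an eigenvalue of $\partial_1^{(T)}$.) The spectral operator $\mathfrak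 a_c=\zeta(\partial_c)$ is called quasi-invertible if for every $T>0$ the operator $\mathfrak a_c^{(T)}$ is invertible, i.e. is a bijection from its domain onto $\mathbb H_c$ with bounded inverse. Then $\mathfrak a_c$ is quasi-invertible if and only if $\zeta(s)\neq 0$ for all $s\in\mathbb C$ with $\operatorname{Re}s=c$. -/

import Mathlib

open MeasureTheory Set
open scoped ENNReal InnerProductSpace

noncomputable section

/-! ### Spectral measures and the measurable functional calculus -/

section FunctionalCalculus

variable {H : Type*} [NormedAddCommGroup H] [InnerProductSpace ℂ H] [CompleteSpace H]

/-- A spectral measure (resolution of the identity) on the Borel sets of `ℂ`: a countably additive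
family of orthogonal projections of the Hilbert space `H`, multiplicative on intersections, with
total mass the identity. Only the values on Borel sets matter. -/
structure SpectralMeasure (H : Type*) [NormedAddCommGroup H] [InnerProductSpace ℂ H]
    [CompleteSpace H] where
  proj : Set ℂ → H →L[ℂ] H
  isStarProjection : ∀ s, MeasurableSet s → IsStarProjection (proj s)
  proj_univ : proj univ = 1
  proj_inter : ∀ s t, MeasurableSet s → MeasurableSet t → proj (s ∩ t) = proj s * proj t
  hasSum_proj : ∀ s : ℕ → Set ℂ, (∀ n, MeasurableSet (s n)) → Pairwise (Function.onFun Disjoint s) →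
    ∀ x, HasSum (fun n => proj (s n) x) (proj (⋃ n, s n) x)

namespace SpectralMeasure

variable (E : SpectralMeasure H)

theorem proj_empty : E.proj ∅ = 0 := by
  ext x
  have h := E.hasSum_proj (fun _ => ∅) (fun _ => MeasurableSet.empty)
    (fun _ _ _ => by simp [Function.onFun]) x
  simpa using (summable_const_iff (β := ℕ) _).1 h.summable

theorem inner_proj_re {s : Set ℂ} (hs : MeasurableSet s) (x : H) :
    (⟪x, E.proj s x⟫_ℂ).re = ‖E.proj s x‖ ^ 2 := by
  have hp := E.isStarProjection s hs
  have h1 : E.proj s x = E.proj s (E.proj s x) := by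
    have := congrArg (fun T : H →L[ℂ] H => T x) hp.isIdempotentElem.eq
    simpa using this.symm
  have h2 : ⟪x, E.proj s x⟫_ℂ = ⟪E.proj s x, E.proj s x⟫_ℂ := by
    conv_lhs => rw [h1]
    rw [← ContinuousLinearMap.adjoint_inner_left,
      ← ContinuousLinearMap.star_eq_adjoint, hp.isSelfAdjoint.star_eq]
  rw [h2, inner_self_eq_norm_sq_to_K]
  norm_cast

/-- The scalar spectral measure `s ↦ ⟪x, E(s) x⟫ = ‖E(s) x‖²` of the vector `x`. -/
def scalarMeasure (x : H) : Measure ℂ :=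
  Measure.ofMeasurable (fun s _ => ENNReal.ofReal (⟪x, E.proj s x⟫_ℂ).re)
    (by simp [E.proj_empty])
    (by
      intro s hs hd
      have h := E.hasSum_proj s hs hd x
      have h1 : HasSum (fun n => ⟪x, E.proj (s n) x⟫_ℂ) ⟪x, E.proj (⋃ n, s n) x⟫_ℂ :=
        h.mapL (innerSL ℂ x)
      have h2 : HasSum (fun n => (⟪x, E.proj (s n) x⟫_ℂ).re)
          (⟪x, E.proj (⋃ n, s n) x⟫_ℂ).re := Complex.hasSum_re h1
      rw [← h2.tsum_eq]
      refine ENNReal.ofReal_tsum_of_nonneg (fun n => ?_) h2.summable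
      rw [E.inner_proj_re (hs n)]
      positivity)

/-- `B` is the operator `∫ f dE`: its domain consists of the `x` with `∫ |f|² dE_{x,x} < ∞`, and
`⟪x, B x⟫ = ∫ f dE_{x,x}` there. By polarization and the linearity of `B` on this dense domain,
`B` is determined by its quadratic form, and `⟪y, B x⟫ = ∫ f dE_{y,x}`. -/
def IsIntegral (f : ℂ → ℂ) (B : H →ₗ.[ℂ] H) : Prop :=
  (∀ x, x ∈ B.domain ↔ MemLp f 2 (E.scalarMeasure x)) ∧
    ∀ x : B.domain, ⟪(x : H), B x⟫_ℂ = ∫ z, f z ∂(E.scalarMeasure (x : H))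

end SpectralMeasure

/-- `B = f(A)` in the sense of the measurable functional calculus for (possibly unbounded) normal
operators: `A = ∫ z dE(z)` and `B = ∫ f(z) dE(z)` for the spectral measure `E` of `A`. -/
def IsFunctionOf (A : H →ₗ.[ℂ] H) (f : ℂ → ℂ) (B : H →ₗ.[ℂ] H) : Prop :=
  ∃ E : SpectralMeasure H, E.IsIntegral id A ∧ E.IsIntegral f B

open Classical in
/-- The operator `f(A)`, for `A` normal and `f` a Borel function. The value `⊥` (the operator with
domain `{0}`) is used when `A` has no spectral measure. -/
def functionalCalculus (A : H →ₗ.[ℂ] H) (f : ℂ → ℂ) : H →ₗ.[ℂ] H :=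
  if h : ∃ B, IsFunctionOf A f B then h.choose else ⊥

/-- A (possibly unbounded) operator is invertible if it is a bijection from its domain onto `H`
with bounded, everywhere defined inverse. -/
def IsInvertibleOperator (A : H →ₗ.[ℂ] H) : Prop :=
  ∃ B : H →L[ℂ] H, (∀ u, ∃ h : B u ∈ A.domain, A ⟨B u, h⟩ = u) ∧ ∀ v : A.domain, B (A v) = v

/-- Multiplication by the scalar `z` on all of `H`. -/
def scalarOperator (H : Type*) [NormedAddCommGroup H] [InnerProductSpace ℂ H] (z : ℂ) :
    H →ₗ.[ℂ] H :=
  (z • (LinearMap.id : H →ₗ[ℂ] H)).toPMap ⊤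

end FunctionalCalculus

/-! ### The weighted Hilbert space and the infinitesimal shift -/

/-- The measure `e^{-2ct} dt` on the real line. -/
def weightMeasure (c : ℝ) : Measure ℝ :=
  volume.withDensity fun t => ENNReal.ofReal (Real.exp (-2 * c * t))

/-- The Hilbert space `L²(ℝ, e^{-2ct} dt)`. -/
abbrev WeightedSpace (c : ℝ) : Type := Lp ℂ 2 (weightMeasure c)

theorem weightMeasure_absolutelyContinuous (c : ℝ) : weightMeasure c ≪ volume :=
  withDensity_absolutelyContinuous _ _

theorem absolutelyContinuous_weightMeasure (c : ℝ) : volume ≪ weightMeasure c := by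
  refine withDensity_absolutelyContinuous' (by fun_prop) (Filter.Eventually.of_forall fun t => ?_)
  simpa using Real.exp_pos _

/-- `g` is (locally) absolutely continuous on the real line. -/
def LocallyAbsolutelyContinuous (g : ℝ → ℂ) : Prop :=
  ∀ a b : ℝ, AbsolutelyContinuousOnInterval g a b

namespace LocallyAbsolutelyContinuous

theorem continuous {g : ℝ → ℂ} (hg : LocallyAbsolutelyContinuous g) : Continuous g := by
  rw [continuous_iff_continuousAt]
  intro x
  refine (hg (x - 1) (x + 1)).continuousOn.continuousAt ?_
  rw [uIcc_of_le (by linarith)]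
  exact Icc_mem_nhds (by linarith) (by linarith)

theorem ae_differentiableAt {g : ℝ → ℂ} (hg : LocallyAbsolutelyContinuous g) :
    ∀ᵐ t, DifferentiableAt ℝ g t := by
  have hl : LocallyBoundedVariationOn g univ := by
    intro a b _ _
    refine (hg a b).boundedVariationOn.mono ?_
    exact inter_subset_right.trans Icc_subset_uIcc
  exact hl.ae_differentiableAt

end LocallyAbsolutelyContinuous

/-- The graph of the differentiation operator: pairs `(f, f')` with `f` (the class of) a locally
absolutely continuous function, `f` and `f'` both in `L²(ℝ, e^{-2ct} dt)`. -/
def shiftGraph (c : ℝ) : Submodule ℂ (WeightedSpace c × WeightedSpace c) where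
  carrier := {p | ∃ g : ℝ → ℂ, LocallyAbsolutelyContinuous g ∧
    p.1 =ᵐ[weightMeasure c] g ∧ p.2 =ᵐ[weightMeasure c] deriv g}
  add_mem' := by
    rintro p q ⟨g, hg, hg1, hg2⟩ ⟨k, hk, hk1, hk2⟩
    refine ⟨g + k, fun a b => (hg a b).add (hk a b), ?_, ?_⟩
    · exact (Lp.coeFn_add _ _).trans (hg1.add hk1)
    · have hd : deriv (g + k) =ᵐ[weightMeasure c] deriv g + deriv k := by
        refine (weightMeasure_absolutelyContinuous c).ae_le ?_
        filter_upwards [hg.ae_differentiableAt, hk.ae_differentiableAt] with t h1 h2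
        exact deriv_add h1 h2
      exact (Lp.coeFn_add _ _).trans ((hg2.add hk2).trans hd.symm)
  zero_mem' := by
    refine ⟨0, fun a b => ?_, Lp.coeFn_zero _ _ _, ?_⟩
    · exact (LipschitzOnWith.absolutelyContinuousOnInterval (K := 0)
        ((LipschitzWith.const (0 : ℂ)).lipschitzOnWith))
    · have : deriv (0 : ℝ → ℂ) = 0 := by ext; simp
      rw [this]
      exact Lp.coeFn_zero _ _ _
  smul_mem' := by
    rintro z p ⟨g, hg, hg1, hg2⟩
    refine ⟨z • g, fun a b => ?_, ?_, ?_⟩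
    · exact (hg a b).const_smul z
    · exact (Lp.coeFn_smul _ _).trans (hg1.const_smul z)
    · have hd : deriv (z • g) = z • deriv g := by
        ext t
        exact deriv_const_smul_field z g
      rw [hd]
      exact (Lp.coeFn_smul _ _).trans (hg2.const_smul z)

theorem shiftGraph_functional (c : ℝ) (p : WeightedSpace c × WeightedSpace c)
    (hp : p ∈ shiftGraph c) (h0 : p.1 = 0) : p.2 = 0 := by
  obtain ⟨g, hg, hg1, hg2⟩ := hp
  have h1 : g =ᵐ[weightMeasure c] (0 : ℝ → ℂ) := by
    rw [h0] at hg1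
    exact hg1.symm.trans (Lp.coeFn_zero _ _ _)
  have h2 : g = 0 := Continuous.ae_eq_iff_eq volume hg.continuous continuous_zero |>.1
    ((absolutelyContinuous_weightMeasure c).ae_le h1)
  have h3 : deriv g = 0 := by rw [h2]; ext; simp
  rw [h3] at hg2
  exact Lp.ext (hg2.trans (Lp.coeFn_zero _ _ _).symm)

/-- The infinitesimal shift `∂_c f = f'`, with domain the `f ∈ L²(ℝ, e^{-2ct} dt)` that are locally
absolutely continuous with `f' ∈ L²(ℝ, e^{-2ct} dt)`. -/
def infinitesimalShift (c : ℝ) : WeightedSpace c →ₗ.[ℂ] WeightedSpace c :=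
  (shiftGraph c).toLinearPMap

theorem infinitesimalShift_graph (c : ℝ) : (infinitesimalShift c).graph = shiftGraph c :=
  Submodule.toLinearPMap_graph_eq _ fun p hp h0 => shiftGraph_functional c p hp h0

/-- The self-adjoint operator `V_c = (∂_c - c) / i`, so that `∂_c = c + i V_c`. -/
def momentumOperator (c : ℝ) : WeightedSpace c →ₗ.[ℂ] WeightedSpace c :=
  Complex.I⁻¹ • (infinitesimalShift c - scalarOperator (WeightedSpace c) c)

/-! ### Truncations and quasi-invertibility -/

/-- `φ` is a `T`-admissible cut-off function: it is continuous on `ℝ` and the closure of its range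
is `[-T, T]`; when `c = 1` it is moreover the restriction to `ℝ` of a meromorphic function on an
open neighborhood of `ℝ` in `ℂ`. -/
def IsAdmissibleCutoff (c T : ℝ) (φ : ℝ → ℝ) : Prop :=
  Continuous φ ∧ closure (range φ) = Icc (-T) T ∧
    (c = 1 → ∃ (U : Set ℂ) (Φ : ℂ → ℂ), IsOpen U ∧ (∀ x : ℝ, (x : ℂ) ∈ U) ∧
      MeromorphicOn Φ U ∧ ∀ x : ℝ, Φ x = φ x)

/-- The truncated infinitesimal shift `c + i φ(V_c)`. As `V_c` is self-adjoint, its spectral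
measure is carried by the real line, so that `φ` may be extended to `ℂ` by `z ↦ φ (Re z)`. -/
def truncatedShift (c : ℝ) (φ : ℝ → ℝ) : WeightedSpace c →ₗ.[ℂ] WeightedSpace c :=
  scalarOperator (WeightedSpace c) c +
    Complex.I • functionalCalculus (momentumOperator c) (fun z => (φ z.re : ℂ))

/-- The truncated spectral operator `ζ(c + i φ(V_c))`. -/
def truncatedSpectralOperator (c : ℝ) (φ : ℝ → ℝ) : WeightedSpace c →ₗ.[ℂ] WeightedSpace c :=
  functionalCalculus (truncatedShift c φ) riemannZeta

/-- Quasi-invertibility of the spectral operator `ζ(∂_c)`, with truncations formed with the family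
of cut-off functions `φ T`, `T > 0`: every truncation is invertible. -/
def IsQuasiInvertible (c : ℝ) (φ : ℝ → ℝ → ℝ) : Prop :=
  ∀ T : ℝ, 0 < T → IsInvertibleOperator (truncatedSpectralOperator c (φ T))

end

/-!
Conjugation by `e^{-ct}` and the Fourier transform turns `V_c` into multiplication by `2πξ`: a
function `g` in `L²(ℝ)` is locally absolutely continuous with derivative `k` in `L²(ℝ)` exactly when
`𝓕 k = 2πiξ · 𝓕 g`. Hence `V_c` has a spectral measure with support `ℝ`, and the spectrum of
`c + i φ(V_c)` is the closure `c + i [-T, T]` of `c + i φ(ℝ)`. An operator `∫ f dE` is invertible if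
and only if `0` is not in the essential range of `f`. The zeros of `ζ` are points of continuity, and
`|ζ|`, which is lower semicontinuous even at the pole, has a minimum on the compact spectrum; so
`ζ(c + i φ(V_c))` is invertible if and only if `ζ` has no zero on this segment. The segments exhaust
the line `Re s = c` as `T` grows.
-/

noncomputable section

open Filter Topology

/-! ### Integrals of measurable functions against a spectral measure -/

theorem linearPMap_eq_of_inner_self_eq {H : Type*} [NormedAddCommGroup H] [InnerProductSpace ℂ H]
    {A B : H →ₗ.[ℂ] H} (hd : A.domain = B.domain) (hdense : Dense (A.domain : Set H))
    (h : ∀ (x : H) (hA : x ∈ A.domain) (hB : x ∈ B.domain), ⟪x, A ⟨x, hA⟩⟫_ℂ = ⟪x, B ⟨x, hB⟩⟫_ℂ) :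
    A = B := by
  obtain ⟨D, A⟩ := A
  obtain ⟨D', B⟩ := B
  obtain rfl : D = D' := hd
  let C : D →ₗ[ℂ] H := A - B
  have inner_self : ∀ x : D, ⟪(x : H), C x⟫_ℂ = 0 := fun x => by
    simpa only [C, LinearMap.sub_apply, inner_sub_right, sub_eq_zero] using! h x x.2 x.2
  have inner : ∀ x y : D, ⟪(y : H), C x⟫_ℂ = 0 := fun x y => by
    have h1 := inner_self (x + y)
    have h2 := inner_self (x + Complex.I • y)
    simp only [map_add, Submodule.coe_add, inner_add_left, inner_add_right, inner_self, map_smul,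
      Submodule.coe_smul, inner_smul_left, inner_smul_right, Complex.conj_I] at h1 h2
    linear_combination (1 / 2 : ℂ) * Complex.I * h2 + (1 / 2 : ℂ) * h1 -
      (1 / 2 : ℂ) * (⟪(x : H), C y⟫_ℂ - ⟪(y : H), C x⟫_ℂ) * Complex.I_mul_I
  exact LinearPMap.ext rfl fun x hx hx' => sub_eq_zero.1 <|
    hdense.eq_zero_of_inner_right ℂ fun y hy => inner ⟨x, hx⟩ ⟨y, hy⟩

namespace SpectralMeasure

variable {H : Type*} [NormedAddCommGroup H] [InnerProductSpace ℂ H] [CompleteSpace H]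
  (E : SpectralMeasure H)

theorem proj_proj {s t : Set ℂ} (hs : MeasurableSet s) (ht : MeasurableSet t) (x : H) :
    E.proj s (E.proj t x) = E.proj (s ∩ t) x := by
  rw [E.proj_inter s t hs ht]; rfl

theorem inner_proj_left {s : Set ℂ} (hs : MeasurableSet s) (x y : H) :
    ⟪E.proj s x, y⟫_ℂ = ⟪x, E.proj s y⟫_ℂ := by
  rw [← ContinuousLinearMap.adjoint_inner_right, ← ContinuousLinearMap.star_eq_adjoint,
    (E.isStarProjection s hs).isSelfAdjoint.star_eq]

theorem proj_union {s t : Set ℂ} (hs : MeasurableSet s) (ht : MeasurableSet t)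
    (hd : Disjoint s t) : E.proj (s ∪ t) = E.proj s + E.proj t := by
  ext x
  let u : ℕ → Set ℂ := fun n => if n = 0 then s else if n = 1 then t else ∅
  have iUnion_u : ⋃ n, u n = s ∪ t := by
    refine subset_antisymm (iUnion_subset fun n => ?_)
      (union_subset (subset_iUnion u 0) (subset_iUnion u 1))
    simp only [u]
    split_ifs <;> simp
  have h := E.hasSum_proj u (fun n => by simp only [u]; split_ifs <;> simp [hs, ht]) (by
    intro m n hmn
    simp only [Function.onFun, u]
    split_ifs <;> simp_all [hd.symm]) x
  have h' : HasSum (fun n => E.proj (u n) x) (∑ n ∈ Finset.range 2, E.proj (u n) x) := by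
    refine hasSum_sum_of_ne_finset_zero fun n hn => ?_
    have : 1 < n := by simpa using hn
    simp [u, show n ≠ 0 by lia, show n ≠ 1 by lia, E.proj_empty]
  rw [← iUnion_u, h.unique h']
  simp [Finset.sum_range_succ, u]

theorem proj_biUnion {ι : Type*} (F : Finset ι) (s : ι → Set ℂ) (hs : ∀ i, MeasurableSet (s i))
    (hd : Pairwise (Function.onFun Disjoint s)) :
    E.proj (⋃ i ∈ F, s i) = ∑ i ∈ F, E.proj (s i) := by
  classical
  induction F using Finset.induction_on with
  | empty => simp [E.proj_empty]
  | insert a F ha ih =>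
    rw [Finset.set_biUnion_insert, E.proj_union (hs a) (F.measurableSet_biUnion fun i _ => hs i),
      Finset.sum_insert ha, ih]
    rw [disjoint_iUnion₂_right]
    exact fun i hi => hd (by rintro rfl; exact ha hi)

theorem scalarMeasure_apply {s : Set ℂ} (hs : MeasurableSet s) (x : H) :
    E.scalarMeasure x s = ‖E.proj s x‖ₑ ^ 2 := by
  rw [scalarMeasure, Measure.ofMeasurable_apply s hs, E.inner_proj_re hs,
    ENNReal.ofReal_pow (norm_nonneg _), ofReal_norm]

theorem scalarMeasure_univ (x : H) : E.scalarMeasure x univ = ‖x‖ₑ ^ 2 := by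
  rw [E.scalarMeasure_apply MeasurableSet.univ, E.proj_univ]; rfl

instance (x : H) : IsFiniteMeasure (E.scalarMeasure x) :=
  ⟨by rw [scalarMeasure_univ]; exact ENNReal.pow_lt_top enorm_lt_top⟩

theorem scalarMeasure_real {s : Set ℂ} (hs : MeasurableSet s) (x : H) :
    ((E.scalarMeasure x).real s : ℂ) = ⟪x, E.proj s x⟫_ℂ := by
  have h : ⟪x, E.proj s x⟫_ℂ = ⟪E.proj s x, E.proj s x⟫_ℂ := by
    rw [E.inner_proj_left hs, E.proj_proj hs hs, inter_self]
  rw [Measure.real, E.scalarMeasure_apply hs, h, inner_self_eq_norm_sq_to_K]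
  simp

theorem scalarMeasure_smul (a : ℂ) (x : H) :
    E.scalarMeasure (a • x) = (‖a‖ₑ ^ 2) • E.scalarMeasure x := by
  ext s hs
  rw [Measure.smul_apply, E.scalarMeasure_apply hs, E.scalarMeasure_apply hs, map_smul, enorm_smul,
    mul_pow, smul_eq_mul]

theorem scalarMeasure_add_le (x y : H) :
    E.scalarMeasure (x + y) ≤ (2 : ℝ≥0∞) • (E.scalarMeasure x + E.scalarMeasure y) := by
  refine Measure.le_iff.2 fun s hs => ?_
  rw [Measure.smul_apply, Measure.add_apply, E.scalarMeasure_apply hs, E.scalarMeasure_apply hs,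
    E.scalarMeasure_apply hs, map_add, smul_eq_mul]
  calc ‖E.proj s x + E.proj s y‖ₑ ^ 2 ≤ (‖E.proj s x‖ₑ + ‖E.proj s y‖ₑ) ^ 2 := by
        gcongr; exact enorm_add_le _ _
    _ ≤ 2 * (‖E.proj s x‖ₑ ^ 2 + ‖E.proj s y‖ₑ ^ 2) := by
        have := ENNReal.rpow_add_le_mul_rpow_add_rpow ‖E.proj s x‖ₑ ‖E.proj s y‖ₑ
          (p := 2) (by norm_num)
        norm_num at this
        exact this

theorem scalarMeasure_proj {s : Set ℂ} (hs : MeasurableSet s) (x : H) :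
    E.scalarMeasure (E.proj s x) = (E.scalarMeasure x).restrict s := by
  ext t ht
  rw [E.scalarMeasure_apply ht, Measure.restrict_apply ht, E.scalarMeasure_apply (ht.inter hs),
    E.proj_proj ht hs]

theorem proj_eq_zero_iff {s : Set ℂ} (hs : MeasurableSet s) :
    E.proj s = 0 ↔ ∀ x, E.scalarMeasure x s = 0 := by
  simp [E.scalarMeasure_apply hs, ContinuousLinearMap.ext_iff]

/-- The integral of a simple function against a spectral measure. -/
def simpleIntegral (g : SimpleFunc ℂ ℂ) : H →L[ℂ] H :=
  ∑ v ∈ g.range, v • E.proj (g ⁻¹' {v})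

theorem simpleIntegral_map {β : Type*} (p : SimpleFunc ℂ β) (F : β → ℂ) :
    E.simpleIntegral (p.map F) = ∑ b ∈ p.range, F b • E.proj (p ⁻¹' {b}) := by
  classical
  rw [simpleIntegral, SimpleFunc.range_map]
  refine Finset.sum_image' _ fun b _ => ?_
  have h : (p.map F) ⁻¹' {F b} = ⋃ i ∈ p.range.filter (fun i => F i = F b), p ⁻¹' {i} := by
    ext z
    simp
  rw [h, E.proj_biUnion _ _ (fun i => p.measurableSet_fiber i), Finset.smul_sum]
  · refine Finset.sum_congr rfl fun i hi => ?_
    rw [(Finset.mem_filter.1 hi).2]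
  · intro i j hij
    exact Disjoint.preimage _ (by simpa using hij)

theorem simpleIntegral_map_add {β : Type*} (p : SimpleFunc ℂ β) (F G : β → ℂ) :
    E.simpleIntegral (p.map (F + G)) =
      E.simpleIntegral (p.map F) + E.simpleIntegral (p.map G) := by
  simp only [simpleIntegral_map, Pi.add_apply, add_smul, Finset.sum_add_distrib]

theorem simpleIntegral_map_mul {β : Type*} (p : SimpleFunc ℂ β) (F G : β → ℂ) :
    E.simpleIntegral (p.map (F * G)) =
      E.simpleIntegral (p.map F) * E.simpleIntegral (p.map G) := by
  simp only [simpleIntegral_map, Finset.sum_mul_sum]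
  refine Finset.sum_congr rfl fun b hb => ?_
  rw [Finset.sum_eq_single_of_mem b hb, smul_mul_smul_comm,
    ← E.proj_inter _ _ (p.measurableSet_fiber _) (p.measurableSet_fiber _), inter_self,
    Pi.mul_apply]
  intro b' _ hb'
  rw [smul_mul_smul_comm, ← E.proj_inter _ _ (p.measurableSet_fiber _) (p.measurableSet_fiber _),
    ← preimage_inter, singleton_inter_eq_empty.2 (by simpa using hb'.symm), preimage_empty,
    E.proj_empty, smul_zero]

theorem simpleIntegral_add (g h : SimpleFunc ℂ ℂ) :
    E.simpleIntegral (g + h) = E.simpleIntegral g + E.simpleIntegral h :=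
  E.simpleIntegral_map_add (g.pair h) Prod.fst Prod.snd

theorem simpleIntegral_mul (g h : SimpleFunc ℂ ℂ) :
    E.simpleIntegral (g * h) = E.simpleIntegral g * E.simpleIntegral h :=
  E.simpleIntegral_map_mul (g.pair h) Prod.fst Prod.snd

theorem simpleIntegral_smul (a : ℂ) (g : SimpleFunc ℂ ℂ) :
    E.simpleIntegral (a • g) = a • E.simpleIntegral g := by
  have h := E.simpleIntegral_map g (fun v => a • v)
  simp only [smul_assoc, ← Finset.smul_sum] at h
  exact h

theorem simpleIntegral_const (a : ℂ) : E.simpleIntegral (SimpleFunc.const ℂ a) = a • 1 := by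
  have h := E.simpleIntegral_map (SimpleFunc.const ℂ ()) (fun _ => a)
  have h' : ⇑(SimpleFunc.const ℂ ()) ⁻¹' {()} = univ := by ext; simp
  rwa [SimpleFunc.map_const, SimpleFunc.range_const, Finset.sum_singleton, h', E.proj_univ] at h

theorem proj_simpleIntegral {s : Set ℂ} (hs : MeasurableSet s) (g : SimpleFunc ℂ ℂ) (x : H) :
    E.proj s (E.simpleIntegral g x) = E.simpleIntegral g (E.proj s x) := by
  simp only [simpleIntegral, _root_.sum_apply, _root_.smul_apply, map_sum, map_smul,
    E.proj_proj hs (g.measurableSet_fiber _), E.proj_proj (g.measurableSet_fiber _) hs, inter_comm]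

theorem inner_simpleIntegral_left (g : SimpleFunc ℂ ℂ) (x y : H) :
    ⟪E.simpleIntegral g x, y⟫_ℂ = ⟪x, E.simpleIntegral (g.map star) y⟫_ℂ := by
  rw [simpleIntegral_map]
  simp only [simpleIntegral, _root_.sum_apply, _root_.smul_apply, sum_inner, inner_sum,
    inner_smul_left, inner_smul_right, E.inner_proj_left (g.measurableSet_fiber _)]
  rfl

theorem inner_simpleIntegral (g : SimpleFunc ℂ ℂ) (x : H) :
    ⟪x, E.simpleIntegral g x⟫_ℂ = ∫ z, g z ∂(E.scalarMeasure x) := by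
  rw [SimpleFunc.integral_eq_sum g (g.integrable_of_isFiniteMeasure), simpleIntegral,
    _root_.sum_apply, inner_sum]
  refine Finset.sum_congr rfl fun v _ => ?_
  rw [_root_.smul_apply, inner_smul_right,
    ← E.scalarMeasure_real (g.measurableSet_fiber v), mul_comm]
  simp

/-- The class in `L²(μ)` of a simple function, as a linear map. -/
def simpleFuncToLp (μ : Measure ℂ) [IsFiniteMeasure μ] : SimpleFunc ℂ ℂ →ₗ[ℂ] Lp ℂ 2 μ where
  toFun g := (g.memLp_of_isFiniteMeasure 2 μ).toLp g
  map_add' _ _ := rfl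
  map_smul' _ _ := rfl

theorem denseRange_simpleFuncToLp (μ : Measure ℂ) [IsFiniteMeasure μ] :
    DenseRange (simpleFuncToLp μ) := by
  refine (Lp.simpleFunc.denseRange (p := 2) (by norm_num)).mono ?_
  rintro _ ⟨g, rfl⟩
  exact ⟨Lp.simpleFunc.toSimpleFunc g,
    congrArg Subtype.val (Lp.simpleFunc.toLp_toSimpleFunc g)⟩

theorem norm_simpleIntegral (g : SimpleFunc ℂ ℂ) (x : H) :
    ‖E.simpleIntegral g x‖ = ‖simpleFuncToLp (E.scalarMeasure x) g‖ := by
  have h : ⟪E.simpleIntegral g x, E.simpleIntegral g x⟫_ℂ =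
      ⟪simpleFuncToLp (E.scalarMeasure x) g, simpleFuncToLp (E.scalarMeasure x) g⟫_ℂ := by
    rw [inner_simpleIntegral_left, ← mul_apply_eq_comp, ← simpleIntegral_mul,
      inner_simpleIntegral, L2.inner_def]
    refine integral_congr_ae ?_
    filter_upwards [(g.memLp_of_isFiniteMeasure 2 (E.scalarMeasure x)).coeFn_toLp] with z hz
    rw [show simpleFuncToLp (E.scalarMeasure x) g z = g z from hz, RCLike.inner_apply, mul_comm]
    rfl
  rw [@norm_eq_sqrt_re_inner ℂ, h, ← @norm_eq_sqrt_re_inner ℂ]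

/-- The evaluation `g ↦ (∫ g dE) x` on simple functions. -/
def simpleIntegralApply (x : H) : SimpleFunc ℂ ℂ →ₗ[ℂ] H where
  toFun g := E.simpleIntegral g x
  map_add' g h := by simp [simpleIntegral_add]
  map_smul' a g := by simp [simpleIntegral_smul]

/-- The isometry of `L²(E_x)` onto the cyclic subspace of `x` which sends the class of `f` to
`(∫ f dE) x`. -/
def cyclicIsometry (x : H) : Lp ℂ 2 (E.scalarMeasure x) →ₗᵢ[ℂ] H where
  toLinearMap := (E.simpleIntegralApply x).extendOfNorm (simpleFuncToLp (E.scalarMeasure x))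
  norm_map' := by
    refine fun u => (denseRange_simpleFuncToLp _).induction_on u ?_ fun g => ?_
    · exact isClosed_eq (by fun_prop) (by fun_prop)
    · rw [ContinuousLinearMap.coe_coe, LinearMap.extendOfNorm_eq (denseRange_simpleFuncToLp _)
        ⟨1, fun g => (one_mul ‖simpleFuncToLp (E.scalarMeasure x) g‖).symm ▸
          (E.norm_simpleIntegral g x).le⟩]
      exact E.norm_simpleIntegral g x

theorem cyclicIsometry_simpleFuncToLp (x : H) (g : SimpleFunc ℂ ℂ) :
    E.cyclicIsometry x (simpleFuncToLp _ g) = E.simpleIntegral g x :=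
  LinearMap.extendOfNorm_eq (denseRange_simpleFuncToLp _)
    ⟨1, fun g => (one_mul ‖simpleFuncToLp (E.scalarMeasure x) g‖).symm ▸
      (E.norm_simpleIntegral g x).le⟩ g

/-- The vectors `x` with `f` square integrable against the scalar measure of `x`. -/
def integralDomain (f : ℂ → ℂ) : Submodule ℂ H where
  carrier := {x | MemLp f 2 (E.scalarMeasure x)}
  add_mem' {x y} hx hy := by
    refine MemLp.of_measure_le_smul (by norm_num) (E.scalarMeasure_add_le x y)
      ⟨hx.1.add_measure hy.1, ?_⟩
    rw [eLpNorm_lt_top_iff_lintegral_rpow_enorm_lt_top (by norm_num) (by norm_num),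
      lintegral_add_measure]
    exact ENNReal.add_lt_top.2
      ⟨lintegral_rpow_enorm_lt_top_of_eLpNorm_lt_top (by norm_num) (by norm_num) hx.2,
        lintegral_rpow_enorm_lt_top_of_eLpNorm_lt_top (by norm_num) (by norm_num) hy.2⟩
  zero_mem' := by
    have : E.scalarMeasure 0 = 0 := by
      rw [← Measure.measure_univ_eq_zero, scalarMeasure_univ]
      simp
    simp [this]
  smul_mem' a x hx := MemLp.of_measure_le_smul (c := ‖a‖ₑ ^ 2) (ENNReal.pow_ne_top enorm_ne_top)
    (E.scalarMeasure_smul a x).le hx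

/-- Simple functions approximating `f` in `L²` of every scalar measure. -/
def approx {f : ℂ → ℂ} (hf : Measurable f) (n : ℕ) : SimpleFunc ℂ ℂ :=
  SimpleFunc.approxOn f hf (range f ∪ {0}) 0 (by simp) n

variable {f : ℂ → ℂ} (hf : Measurable f)

theorem tendsto_eLpNorm_approx_sub {μ : Measure ℂ} (h : MemLp f 2 μ) :
    Tendsto (fun n => eLpNorm (⇑(approx hf n) - f) 2 μ) atTop (𝓝 0) :=
  SimpleFunc.tendsto_approxOn_range_Lp_eLpNorm (by norm_num) hf h.2

theorem tendsto_cyclicIsometry_toLp {x : H} {u : ℕ → ℂ → ℂ}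
    (hu : ∀ n, MemLp (u n) 2 (E.scalarMeasure x)) (hf : MemLp f 2 (E.scalarMeasure x))
    (h : Tendsto (fun n => eLpNorm (u n - f) 2 (E.scalarMeasure x)) atTop (𝓝 0)) :
    Tendsto (fun n => E.cyclicIsometry x ((hu n).toLp (u n))) atTop
      (𝓝 (E.cyclicIsometry x (hf.toLp f))) :=
  ((E.cyclicIsometry x).continuous.tendsto _).comp
    ((Lp.tendsto_Lp_iff_tendsto_eLpNorm'' u hu f hf).2 h)

theorem tendsto_simpleIntegral_approx {x : H} (hx : MemLp f 2 (E.scalarMeasure x)) :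
    Tendsto (fun n => E.simpleIntegral (approx hf n) x) atTop
      (𝓝 (E.cyclicIsometry x (hx.toLp f))) := by
  simp only [← cyclicIsometry_simpleFuncToLp]
  exact E.tendsto_cyclicIsometry_toLp (fun n => (approx hf n).memLp_of_isFiniteMeasure _ _) hx
    (tendsto_eLpNorm_approx_sub hf hx)

/-- The operator `∫ f dE`. -/
def integral : H →ₗ.[ℂ] H where
  domain := E.integralDomain f
  toFun :=
    { toFun x := E.cyclicIsometry x (MemLp.toLp f x.2)
      map_add' x y := by
        refine tendsto_nhds_unique (E.tendsto_simpleIntegral_approx hf (x + y).2) ?_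
        simpa using (E.tendsto_simpleIntegral_approx hf x.2).add
          (E.tendsto_simpleIntegral_approx hf y.2)
      map_smul' a x := by
        refine tendsto_nhds_unique (E.tendsto_simpleIntegral_approx hf (a • x).2) ?_
        simpa using (E.tendsto_simpleIntegral_approx hf x.2).const_smul a }

theorem cyclicIsometry_const (x : H) (a : ℂ) :
    E.cyclicIsometry x (simpleFuncToLp _ (SimpleFunc.const ℂ a)) = a • x := by
  simp [cyclicIsometry_simpleFuncToLp, simpleIntegral_const]

theorem inner_cyclicIsometry (x : H) (u : Lp ℂ 2 (E.scalarMeasure x)) :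
    ⟪x, E.cyclicIsometry x u⟫_ℂ = ∫ z, u z ∂(E.scalarMeasure x) := by
  have h : E.cyclicIsometry x (simpleFuncToLp _ (SimpleFunc.const ℂ 1)) = x := by
    rw [cyclicIsometry_const, one_smul]
  rw [show ⟪x, E.cyclicIsometry x u⟫_ℂ = ⟪E.cyclicIsometry x _, E.cyclicIsometry x u⟫_ℂ from
    congrArg (⟪·, E.cyclicIsometry x u⟫_ℂ) h.symm, LinearIsometry.inner_map_map, L2.inner_def]
  refine integral_congr_ae ?_
  filter_upwards [((SimpleFunc.const ℂ (1 : ℂ)).memLp_of_isFiniteMeasure 2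
    (E.scalarMeasure x)).coeFn_toLp] with z hz
  rw [show simpleFuncToLp (E.scalarMeasure x) (SimpleFunc.const ℂ 1) z = 1 from hz]
  simp

include hf in
theorem proj_mem_integralDomain {s : Set ℂ} (hs : MeasurableSet s) {C : ℝ}
    (hC : ∀ z ∈ s, ‖f z‖ ≤ C) (x : H) : E.proj s x ∈ E.integralDomain f := by
  change MemLp f 2 _
  rw [E.scalarMeasure_proj hs]
  exact MemLp.of_bound hf.aestronglyMeasurable C (ae_restrict_of_forall_mem hs hC)

include hf in
theorem dense_integralDomain : Dense (E.integralDomain f : Set H) := by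
  rw [Submodule.dense_iff_topologicalClosure_eq_top, Submodule.topologicalClosure_eq_top_iff,
    eq_bot_iff]
  intro x hx
  let s : ℕ → Set ℂ := fun n => {z | ‖f z‖ ≤ n}
  have hs : ∀ n, MeasurableSet (s n) := fun n => measurableSet_le hf.norm measurable_const
  have iUnion_s : ⋃ n, s n = univ := iUnion_eq_univ_iff.2 fun z => exists_nat_ge ‖f z‖
  have null : ∀ n, E.scalarMeasure x (s n) = 0 := fun n => by
    have h := hx _ (E.proj_mem_integralDomain hf (hs n) (fun z hz => hz) x)
    rw [E.inner_proj_left (hs n), ← E.scalarMeasure_real (hs n)] at h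
    exact (measureReal_eq_zero_iff).1 (by exact_mod_cast h)
  have h := measure_iUnion_null null
  rw [iUnion_s, E.scalarMeasure_univ] at h
  simpa using h

theorem isIntegral_integral : E.IsIntegral f (E.integral hf) := by
  refine ⟨fun x => Iff.rfl, fun x => (E.inner_cyclicIsometry x _).trans ?_⟩
  exact integral_congr_ae (MemLp.coeFn_toLp x.2)

theorem enorm_integral_sub_smul (a : ℂ) (x : (E.integral hf).domain) :
    ‖E.integral hf x - a • (x : H)‖ₑ = eLpNorm (fun z => f z - a) 2 (E.scalarMeasure (x : H)) := by
  have hx : MemLp f 2 (E.scalarMeasure (x : H)) := x.2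
  rw [show E.integral hf x = E.cyclicIsometry x (hx.toLp f) from rfl, ← E.cyclicIsometry_const,
    ← map_sub, LinearIsometry.enorm_map]
  exact Lp.enorm_toLp (hf := hx.sub (memLp_const a))

theorem enorm_integral (x : (E.integral hf).domain) :
    ‖E.integral hf x‖ₑ = eLpNorm f 2 (E.scalarMeasure (x : H)) := by
  simpa using E.enorm_integral_sub_smul hf 0 x

variable {E}

theorem IsIntegral.eq_integral {B : H →ₗ.[ℂ] H} (hB : E.IsIntegral f B) :
    B = E.integral hf := by
  have hd : B.domain = (E.integral hf).domain := Submodule.ext hB.1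
  refine linearPMap_eq_of_inner_self_eq hd (hd ▸ E.dense_integralDomain hf) fun x h1 h2 => ?_
  rw [hB.2 ⟨x, h1⟩, (E.isIntegral_integral hf).2 ⟨x, h2⟩]

variable (E)

theorem proj_mem_integralDomain_of_mem {s : Set ℂ} (hs : MeasurableSet s) {x : H}
    (hx : x ∈ E.integralDomain f) : E.proj s x ∈ E.integralDomain f := by
  change MemLp f 2 _
  rw [E.scalarMeasure_proj hs]
  exact hx.restrict s

theorem proj_integral {s : Set ℂ} (hs : MeasurableSet s) (x : (E.integral hf).domain) :
    E.proj s (E.integral hf x) =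
      E.integral hf ⟨E.proj s x, E.proj_mem_integralDomain_of_mem hs x.2⟩ := by
  refine tendsto_nhds_unique ?_ (E.tendsto_simpleIntegral_approx hf _)
  simpa only [Function.comp_def, E.proj_simpleIntegral hs] using!
    ((E.proj s).continuous.tendsto _).comp (E.tendsto_simpleIntegral_approx hf x.2)

theorem scalarMeasure_integral (x : (E.integral hf).domain) :
    E.scalarMeasure (E.integral hf x) =
      (E.scalarMeasure (x : H)).withDensity fun z => ‖f z‖ₑ ^ 2 := by
  ext s hs
  rw [E.scalarMeasure_apply hs, E.proj_integral hf hs, enorm_integral, withDensity_apply _ hs,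
    E.scalarMeasure_proj hs]
  simpa using eLpNorm_nnreal_pow_eq_lintegral (f := f) (p := 2)
    (μ := (E.scalarMeasure (x : H)).restrict s) two_ne_zero

theorem eLpNorm_scalarMeasure_integral {g : ℂ → ℂ} (hg : Measurable g)
    (x : (E.integral hf).domain) :
    eLpNorm g 2 (E.scalarMeasure (E.integral hf x)) =
      eLpNorm (g * f) 2 (E.scalarMeasure (x : H)) := by
  simp only [eLpNorm_eq_lintegral_rpow_enorm_toReal two_ne_zero ENNReal.ofNat_ne_top,
    ENNReal.toReal_ofNat, ENNReal.rpow_ofNat, E.scalarMeasure_integral,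
    lintegral_withDensity_eq_lintegral_mul _ (show Measurable fun z => ‖f z‖ₑ ^ 2 by fun_prop)
      (show Measurable fun z => ‖g z‖ₑ ^ 2 by fun_prop)]
  simp [mul_pow, mul_comm]

theorem integral_mem_integralDomain_iff {g : ℂ → ℂ} (hg : Measurable g)
    (x : (E.integral hf).domain) :
    E.integral hf x ∈ E.integralDomain g ↔ (x : H) ∈ E.integralDomain (g * f) := by
  change MemLp _ _ _ ↔ MemLp _ _ _
  simp only [MemLp, E.eLpNorm_scalarMeasure_integral hf hg, hg.aestronglyMeasurable,
    (hg.mul hf).aestronglyMeasurable, true_and]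

theorem simpleIntegral_integral (h : SimpleFunc ℂ ℂ) (x : (E.integral hf).domain)
    (hx : MemLp (⇑h * f) 2 (E.scalarMeasure (x : H))) :
    E.simpleIntegral h (E.integral hf x) = E.cyclicIsometry x (hx.toLp _) := by
  have tendsto_mul : Tendsto (fun n => E.simpleIntegral (h * approx hf n) (x : H)) atTop
      (𝓝 (E.simpleIntegral h (E.integral hf x))) := by
    simp only [simpleIntegral_mul]
    exact ((E.simpleIntegral h).continuous.tendsto _).comp
      (E.tendsto_simpleIntegral_approx hf x.2)
  refine tendsto_nhds_unique tendsto_mul ?_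
  simp only [← cyclicIsometry_simpleFuncToLp]
  refine E.tendsto_cyclicIsometry_toLp
    (fun n => (h * approx hf n).memLp_of_isFiniteMeasure _ _) hx ?_
  obtain ⟨C, hC⟩ := h.exists_forall_norm_le
  have bound : ∀ n, eLpNorm (⇑(h * approx hf n) - ⇑h * f) 2 (E.scalarMeasure (x : H)) ≤
      ENNReal.ofReal C * eLpNorm (⇑(approx hf n) - f) 2 (E.scalarMeasure (x : H)) := fun n => by
    refine eLpNorm_le_mul_eLpNorm_of_ae_le_mul (Eventually.of_forall fun z => ?_) 2
    rw [SimpleFunc.coe_mul, ← mul_sub, Pi.mul_apply, norm_mul]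
    gcongr
    exact hC z
  refine tendsto_of_tendsto_of_tendsto_of_le_of_le tendsto_const_nhds ?_ (fun _ => zero_le) bound
  simpa using ENNReal.Tendsto.const_mul (tendsto_eLpNorm_approx_sub hf x.2)
    (Or.inr ENNReal.ofReal_ne_top)

theorem integral_integral {g : ℂ → ℂ} (hg : Measurable g) (x : (E.integral hf).domain)
    (hx : (x : H) ∈ E.integralDomain (g * f)) :
    E.integral hg ⟨E.integral hf x, (E.integral_mem_integralDomain_iff hf hg x).2 hx⟩ =
      E.integral (hg.mul hf) ⟨x, hx⟩ := by
  refine tendsto_nhds_unique (E.tendsto_simpleIntegral_approx hg _) ?_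
  have hn : ∀ n, MemLp (⇑(approx hg n) * f) 2 (E.scalarMeasure (x : H)) := fun n =>
    (E.integral_mem_integralDomain_iff hf (approx hg n).measurable x).1
      ((approx hg n).memLp_of_isFiniteMeasure _ _)
  simp only [E.simpleIntegral_integral hf _ x (hn _)]
  refine E.tendsto_cyclicIsometry_toLp hn hx ?_
  simp only [← sub_mul, ← E.eLpNorm_scalarMeasure_integral hf ((approx hg _).measurable.sub hg)]
  exact tendsto_eLpNorm_approx_sub hg ((E.integral_mem_integralDomain_iff hf hg x).2 hx)

end SpectralMeasure

/-! ### Essential range and invertibility -/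

/-- The approximate point spectrum of a partially defined operator: the `a` for which `A - a` is not
bounded below. -/
def approximatePointSpectrum {H : Type*} [NormedAddCommGroup H] [InnerProductSpace ℂ H]
    (A : H →ₗ.[ℂ] H) : Set ℂ :=
  {a | ∀ ε : ℝ, 0 < ε → ∃ x : A.domain, ‖A x - a • (x : H)‖ < ε * ‖(x : H)‖}

theorem IsInvertibleOperator.zero_notMem_approximatePointSpectrum {H : Type*}
    [NormedAddCommGroup H] [InnerProductSpace ℂ H] {A : H →ₗ.[ℂ] H}
    (hA : IsInvertibleOperator A) : 0 ∉ approximatePointSpectrum A := by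
  intro h
  obtain ⟨B, -, hB⟩ := hA
  obtain ⟨x, hx⟩ := h (1 / (‖B‖ + 1)) (by positivity)
  rw [zero_smul, sub_zero, div_mul_eq_mul_div, one_mul, lt_div_iff₀ (by positivity)] at hx
  have le : ‖(x : H)‖ ≤ ‖B‖ * ‖A x‖ := by simpa only [hB x] using B.le_opNorm (A x)
  nlinarith [norm_nonneg (A x)]

namespace SpectralMeasure

variable {H : Type*} [NormedAddCommGroup H] [InnerProductSpace ℂ H] [CompleteSpace H]
  (E : SpectralMeasure H)

/-- The essential range of `f` with respect to a spectral measure. That of the identity is the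
support of the spectral measure. -/
def essentialRange (f : ℂ → ℂ) : Set ℂ :=
  {a | ∀ ε : ℝ, 0 < ε → E.proj (f ⁻¹' Metric.ball a ε) ≠ 0}

theorem proj_ne_zero_mono {s t : Set ℂ} (hs : MeasurableSet s) (ht : MeasurableSet t)
    (hst : s ⊆ t) (h : E.proj s ≠ 0) : E.proj t ≠ 0 := by
  intro h0
  rw [← inter_eq_left.2 hst, E.proj_inter s t hs ht, h0, mul_zero] at h
  exact h rfl

theorem eLpNorm_const_scalarMeasure (a : ℝ) (x : H) :
    eLpNorm (fun _ : ℂ => a) 2 (E.scalarMeasure x) = ‖a * ‖x‖‖ₑ := by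
  rw [eLpNorm_const' a two_ne_zero ENNReal.ofNat_ne_top, E.scalarMeasure_univ,
    ← ENNReal.rpow_natCast, ← ENNReal.rpow_mul, enorm_mul, enorm_norm]
  norm_num

variable {f : ℂ → ℂ} (hf : Measurable f)

include hf in
theorem isClosed_essentialRange : IsClosed (E.essentialRange f) := by
  refine isClosed_of_closure_subset fun a ha ε hε => ?_
  obtain ⟨b, hb, hab⟩ := Metric.mem_closure_iff.1 ha (ε / 2) (by positivity)
  refine E.proj_ne_zero_mono (hf measurableSet_ball) (hf measurableSet_ball)
    (preimage_mono (Metric.ball_subset_ball' ?_)) (hb (ε / 2) (by positivity))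
  rw [dist_comm] at hab
  linarith

include hf in
theorem mem_essentialRange_of_continuousAt {z : ℂ} (hz : z ∈ E.essentialRange id)
    (hfz : ContinuousAt f z) : f z ∈ E.essentialRange f := by
  intro ε hε
  obtain ⟨δ, hδ, hsub⟩ := Metric.mem_nhds_iff.1 (hfz (Metric.ball_mem_nhds (f z) hε))
  exact E.proj_ne_zero_mono measurableSet_ball (hf measurableSet_ball) hsub (hz δ hδ)

theorem scalarMeasure_compl_essentialRange_id (x : H) :
    E.scalarMeasure x (E.essentialRange id)ᶜ = 0 := by
  refine measure_null_of_locally_null _ fun a ha => ?_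
  obtain ⟨ε, hε, h⟩ : ∃ ε > 0, E.proj (Metric.ball a ε) = 0 := by
    simpa [essentialRange] using ha
  exact ⟨Metric.ball a ε, mem_nhdsWithin_of_mem_nhds (Metric.ball_mem_nhds a hε),
    (E.proj_eq_zero_iff measurableSet_ball).1 h x⟩

include hf in
theorem essentialRange_subset_closure_image :
    E.essentialRange f ⊆ closure (f '' E.essentialRange id) := by
  refine fun a ha => Metric.mem_closure_iff.2 fun ε hε => ?_
  by_contra! h
  have disjoint : f ⁻¹' Metric.ball a ε ⊆ (E.essentialRange id)ᶜ := fun z hz hzK =>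
    (h _ (mem_image_of_mem f hzK)).not_gt (Metric.mem_ball'.1 hz)
  exact ha ε hε ((E.proj_eq_zero_iff (hf measurableSet_ball)).2 fun x =>
    measure_mono_null disjoint (E.scalarMeasure_compl_essentialRange_id x))

theorem essentialRange_of_continuous (hf : Continuous f) :
    E.essentialRange f = closure (f '' E.essentialRange id) := by
  refine (E.essentialRange_subset_closure_image hf.measurable).antisymm
    (closure_minimal ?_ (E.isClosed_essentialRange hf.measurable))
  rintro _ ⟨z, hz, rfl⟩
  exact E.mem_essentialRange_of_continuousAt hf.measurable hz hf.continuousAt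

include hf in
theorem exists_le_norm_sub_of_notMem_essentialRange {a : ℂ} (ha : a ∉ E.essentialRange f) :
    ∃ ε : ℝ, 0 < ε ∧ ∀ x, ∀ᵐ z ∂(E.scalarMeasure x), ε ≤ ‖f z - a‖ := by
  obtain ⟨ε, hε, h⟩ : ∃ ε > 0, E.proj (f ⁻¹' Metric.ball a ε) = 0 := by
    simpa [essentialRange] using ha
  refine ⟨ε, hε, fun x => ?_⟩
  filter_upwards [measure_eq_zero_iff_ae_notMem.1
    ((E.proj_eq_zero_iff (hf measurableSet_ball)).1 h x)] with z hz
  simpa [dist_eq_norm] using hz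

theorem le_norm_integral_sub_smul {a : ℂ} {ε : ℝ} (hε : 0 ≤ ε) (x : (E.integral hf).domain)
    (h : ∀ᵐ z ∂(E.scalarMeasure (x : H)), ε ≤ ‖f z - a‖) :
    ε * ‖(x : H)‖ ≤ ‖E.integral hf x - a • (x : H)‖ := by
  have := eLpNorm_mono_ae (p := 2) (h.mono fun z hz => (Real.norm_of_nonneg hε).trans_le hz)
  rwa [E.eLpNorm_const_scalarMeasure, ← E.enorm_integral_sub_smul hf, enorm_le_iff_norm_le,
    Real.norm_of_nonneg (by positivity)] at this

theorem norm_integral_sub_smul_le {a : ℂ} {ε : ℝ} (hε : 0 ≤ ε) (x : (E.integral hf).domain)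
    (h : ∀ᵐ z ∂(E.scalarMeasure (x : H)), ‖f z - a‖ ≤ ε) :
    ‖E.integral hf x - a • (x : H)‖ ≤ ε * ‖(x : H)‖ := by
  have := eLpNorm_mono_ae (p := 2) (h.mono fun z hz => hz.trans_eq (Real.norm_of_nonneg hε).symm)
  rwa [E.eLpNorm_const_scalarMeasure, ← E.enorm_integral_sub_smul hf, enorm_le_iff_norm_le,
    Real.norm_of_nonneg (by positivity)] at this

theorem essentialRange_subset_approximatePointSpectrum_integral :
    E.essentialRange f ⊆ approximatePointSpectrum (E.integral hf) := by
  intro a ha ε hε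
  let s := f ⁻¹' Metric.ball a (ε / 2)
  have hs : MeasurableSet s := hf measurableSet_ball
  have norm_sub_le : ∀ z ∈ s, ‖f z - a‖ ≤ ε / 2 := fun z hz =>
    (mem_ball_iff_norm.1 hz).le
  obtain ⟨y, hy⟩ : ∃ y, E.proj s y ≠ 0 := by
    by_contra! h
    exact ha (ε / 2) (by positivity) (ContinuousLinearMap.ext h)
  let x : (E.integral hf).domain := ⟨E.proj s y, E.proj_mem_integralDomain hf hs
    (fun z hz => (norm_le_norm_sub_add (f z) a).trans
      (add_le_add_left (norm_sub_le z hz) ‖a‖)) y⟩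
  refine ⟨x, (E.norm_integral_sub_smul_le hf (half_pos hε).le x ?_).trans_lt ?_⟩
  · rw [E.scalarMeasure_proj hs]
    exact ae_restrict_of_forall_mem hs norm_sub_le
  · have : 0 < ‖(x : H)‖ := norm_pos_iff.2 hy
    nlinarith

theorem approximatePointSpectrum_integral :
    approximatePointSpectrum (E.integral hf) = E.essentialRange f := by
  refine Subset.antisymm (fun a ha => ?_)
    (E.essentialRange_subset_approximatePointSpectrum_integral hf)
  by_contra h
  obtain ⟨ε, hε, hle⟩ := E.exists_le_norm_sub_of_notMem_essentialRange hf h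
  obtain ⟨x, hx⟩ := ha ε hε
  exact hx.not_ge (E.le_norm_integral_sub_smul hf hε.le x (hle x))

theorem integral_eq_self {x : (E.integral hf).domain} (h : f =ᵐ[E.scalarMeasure (x : H)] 1) :
    E.integral hf x = x := by
  rw [← sub_eq_zero, ← enorm_eq_zero, ← one_smul ℂ (x : H), E.enorm_integral_sub_smul hf,
    eLpNorm_eq_zero_iff (by fun_prop) two_ne_zero]
  filter_upwards [h] with z hz
  simp [hz]

theorem integral_integral_eq_self {g : ℂ → ℂ} (hg : Measurable g) {x : (E.integral hf).domain}
    (h : g * f =ᵐ[E.scalarMeasure (x : H)] 1) :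
    ∃ hx : E.integral hf x ∈ (E.integral hg).domain, E.integral hg ⟨E.integral hf x, hx⟩ = x := by
  have hx : (x : H) ∈ E.integralDomain (g * f) := (memLp_congr_ae h).2 (memLp_const 1)
  exact ⟨(E.integral_mem_integralDomain_iff hf hg x).2 hx,
    (E.integral_integral hf hg x hx).trans (E.integral_eq_self (hg.mul hf) h)⟩

theorem exists_continuousLinearMap_eq_integral {C : ℝ} (hC : 0 ≤ C)
    (h : ∀ x, ∀ᵐ z ∂(E.scalarMeasure x), ‖f z‖ ≤ C) :
    ∃ L : H →L[ℂ] H, ∀ x, ∃ hx : x ∈ E.integralDomain f, L x = E.integral hf ⟨x, hx⟩ := by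
  have hx : ∀ x, x ∈ E.integralDomain f := fun x =>
    MemLp.of_bound hf.aestronglyMeasurable C (h x)
  refine ⟨LinearMap.mkContinuous
    ((E.integral hf).toFun ∘ₗ LinearMap.codRestrict _ LinearMap.id hx) C fun x => ?_,
    fun x => ⟨hx x, rfl⟩⟩
  simpa using! E.norm_integral_sub_smul_le hf (a := 0) hC ⟨x, hx x⟩ (by simpa using h x)

theorem isInvertibleOperator_integral (h : 0 ∉ E.essentialRange f) :
    IsInvertibleOperator (E.integral hf) := by
  obtain ⟨ε, hε, hle⟩ := E.exists_le_norm_sub_of_notMem_essentialRange hf h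
  simp only [sub_zero] at hle
  obtain ⟨L, hL⟩ := E.exists_continuousLinearMap_eq_integral hf.inv (inv_nonneg.2 hε.le)
    fun x => (hle x).mono fun z hz => by
      rw [Pi.inv_apply, norm_inv]
      exact inv_anti₀ hε hz
  choose hx hL using hL
  have mul_inv : ∀ x, f * f⁻¹ =ᵐ[E.scalarMeasure x] 1 := fun x =>
    (hle x).mono fun z hz => mul_inv_cancel₀ (norm_pos_iff.1 (hε.trans_le hz))
  refine ⟨L, fun u => ?_, fun v => ?_⟩
  · rw [hL]
    exact E.integral_integral_eq_self hf.inv hf (x := ⟨u, hx u⟩) (mul_inv u)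
  · rw [hL]
    exact (E.integral_integral_eq_self hf hf.inv (mul_comm f f⁻¹ ▸ mul_inv v)).2

variable {E} {B : H →ₗ.[ℂ] H}

include hf in
theorem IsIntegral.approximatePointSpectrum_eq (hB : E.IsIntegral f B) :
    approximatePointSpectrum B = E.essentialRange f := by
  rw [hB.eq_integral hf, approximatePointSpectrum_integral]

include hf in
theorem IsIntegral.isInvertibleOperator_iff (hB : E.IsIntegral f B) :
    IsInvertibleOperator B ↔ 0 ∉ E.essentialRange f := by
  refine ⟨fun h => ?_, fun h => ?_⟩
  · rw [← hB.approximatePointSpectrum_eq hf]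
    exact h.zero_notMem_approximatePointSpectrum
  · rw [hB.eq_integral hf]
    exact E.isInvertibleOperator_integral hf h

variable (E)

/-- The push-forward of a spectral measure under a Borel map. -/
def map {g : ℂ → ℂ} (hg : Measurable g) : SpectralMeasure H where
  proj s := E.proj (g ⁻¹' s)
  isStarProjection s hs := E.isStarProjection _ (hg hs)
  proj_univ := by rw [preimage_univ, E.proj_univ]
  proj_inter s t hs ht := by rw [preimage_inter, E.proj_inter _ _ (hg hs) (hg ht)]
  hasSum_proj s hs hd x := by
    rw [preimage_iUnion]
    exact E.hasSum_proj _ (fun n => hg (hs n)) (fun i j hij => (hd hij).preimage g) x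

theorem scalarMeasure_map {g : ℂ → ℂ} (hg : Measurable g) (x : H) :
    (E.map hg).scalarMeasure x = (E.scalarMeasure x).map g := by
  ext s hs
  rw [Measure.map_apply hg hs, scalarMeasure_apply _ hs, scalarMeasure_apply _ (hg hs)]
  rfl

variable {E}

include hf in
theorem isIntegral_map_iff {g : ℂ → ℂ} (hg : Measurable g) :
    (E.map hg).IsIntegral f B ↔ E.IsIntegral (f ∘ g) B := by
  have memLp_iff : ∀ x, MemLp f 2 ((E.map hg).scalarMeasure x) ↔
      MemLp (f ∘ g) 2 (E.scalarMeasure x) := fun x => by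
    rw [scalarMeasure_map, memLp_map_measure_iff hf.aestronglyMeasurable hg.aemeasurable]
  have integral_eq : ∀ x, ∫ z, f z ∂((E.map hg).scalarMeasure x) =
      ∫ z, (f ∘ g) z ∂(E.scalarMeasure x) := fun x => by
    rw [scalarMeasure_map, integral_map hg.aemeasurable hf.aestronglyMeasurable]
    rfl
  simp only [IsIntegral, memLp_iff, integral_eq]

theorem IsIntegral.scalarOperator_add_smul (hB : E.IsIntegral f B) (a : ℂ) {b : ℂ} (hb : b ≠ 0) :
    E.IsIntegral (fun z => a + b * f z) (scalarOperator H a + b • B) := by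
  have mem_domain : ∀ x, x ∈ (scalarOperator H a + b • B).domain ↔ x ∈ B.domain := by
    simp [LinearPMap.add_domain, scalarOperator]
  refine ⟨fun x => ?_, fun x => ?_⟩
  · rw [mem_domain, hB.1]
    refine ⟨fun h => (memLp_const a).add (h.const_mul b), fun h => ?_⟩
    convert (h.sub (memLp_const a)).const_mul b⁻¹ using 2 with z
    simp [hb]
  · have hx : (x : H) ∈ B.domain := (mem_domain x).1 x.2
    have hi : Integrable f (E.scalarMeasure (x : H)) := ((hB.1 x).1 hx).integrable one_le_two
    have apply_eq : (scalarOperator H a + b • B) x = a • (x : H) + b • B ⟨x, hx⟩ := rfl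
    rw [apply_eq, inner_add_right, inner_smul_right, inner_smul_right, hB.2 ⟨x, hx⟩,
      integral_add (integrable_const _) (hi.const_mul _), integral_const_mul, integral_const,
      Measure.real, E.scalarMeasure_univ, inner_self_eq_norm_sq_to_K, Complex.real_smul, mul_comm]
    simp

end SpectralMeasure

variable {H : Type*} [NormedAddCommGroup H] [InnerProductSpace ℂ H] [CompleteSpace H]

theorem isFunctionOf_functionalCalculus {A : H →ₗ.[ℂ] H} {E : SpectralMeasure H}
    (hA : E.IsIntegral id A) {f : ℂ → ℂ} (hf : Measurable f) :
    IsFunctionOf A f (functionalCalculus A f) := by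
  have h : ∃ B, IsFunctionOf A f B := ⟨_, E, hA, E.isIntegral_integral hf⟩
  rw [functionalCalculus, dif_pos h]
  exact h.choose_spec

/-! ### The spectral measure of a multiplication operator -/

section Multiplication

variable {α : Type*} [MeasurableSpace α] {ν : Measure α} {s t : Set α}

theorem memLp_top_indicator_one (ν : Measure α) (hs : MeasurableSet s) :
    MemLp (s.indicator fun _ => (1 : ℂ)) ∞ ν :=
  (memLp_top_const 1).indicator hs

open Classical in
/-- Multiplication by the indicator function of a measurable set, as an operator on `L²`. The value
`0` is used for a set that is not measurable. -/
def indicatorOperator (ν : Measure α) (s : Set α) : Lp ℂ 2 ν →L[ℂ] Lp ℂ 2 ν :=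
  if hs : MeasurableSet s then
    (ContinuousLinearMap.mul ℂ ℂ).holderL ν ∞ 2 2 (memLp_top_indicator_one ν hs).toLp
  else 0

theorem coeFn_indicatorOperator (hs : MeasurableSet s) (f : Lp ℂ 2 ν) :
    indicatorOperator ν s f =ᵐ[ν] s.indicator f := by
  rw [indicatorOperator, dif_pos hs, ContinuousLinearMap.holderL_apply_apply]
  filter_upwards [(ContinuousLinearMap.mul ℂ ℂ).coeFn_holder (r := 2)
    (memLp_top_indicator_one ν hs).toLp f,
    (memLp_top_indicator_one ν hs).coeFn_toLp] with z hz h1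
  rw [hz, h1]
  by_cases hzs : z ∈ s <;> simp [hzs]

theorem indicatorOperator_univ : indicatorOperator ν univ = 1 := by
  ext1 f
  refine Lp.ext ((coeFn_indicatorOperator MeasurableSet.univ f).trans ?_)
  rw [indicator_univ]
  rfl

theorem indicatorOperator_inter (hs : MeasurableSet s) (ht : MeasurableSet t) :
    indicatorOperator ν (s ∩ t) = indicatorOperator ν s * indicatorOperator ν t := by
  ext1 f
  refine Lp.ext ?_
  filter_upwards [coeFn_indicatorOperator (hs.inter ht) f, coeFn_indicatorOperator ht f,
    coeFn_indicatorOperator hs (indicatorOperator ν t f)] with z h1 h2 h3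
  refine h1.trans (Eq.trans ?_ h3.symm)
  by_cases hzs : z ∈ s <;> by_cases hzt : z ∈ t <;> simp [hzs, hzt, h2]

theorem indicatorOperator_union (hs : MeasurableSet s) (ht : MeasurableSet t)
    (hst : Disjoint s t) (f : Lp ℂ 2 ν) :
    indicatorOperator ν (s ∪ t) f = indicatorOperator ν s f + indicatorOperator ν t f := by
  refine Lp.ext ?_
  filter_upwards [coeFn_indicatorOperator (hs.union ht) f, coeFn_indicatorOperator hs f,
    coeFn_indicatorOperator ht f,
    Lp.coeFn_add (indicatorOperator ν s f) (indicatorOperator ν t f)] with z h h1 h2 h3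
  rw [h, h3, Pi.add_apply, h1, h2, indicator_union_of_disjoint hst]

theorem indicatorOperator_biUnion {ι : Type*} {s : ι → Set α} (hs : ∀ i, MeasurableSet (s i))
    (hd : Pairwise (Function.onFun Disjoint s)) (F : Finset ι) (f : Lp ℂ 2 ν) :
    indicatorOperator ν (⋃ i ∈ F, s i) f = ∑ i ∈ F, indicatorOperator ν (s i) f := by
  refine Lp.ext ?_
  filter_upwards [coeFn_indicatorOperator (F.measurableSet_biUnion fun i _ => hs i) f,
    Lp.coeFn_finsetSum F (fun i => indicatorOperator ν (s i) f),
    (eventually_all_finset F).2 fun i _ => coeFn_indicatorOperator (hs i) f] with z h1 h2 h3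
  rw [h1, h2, Finset.sum_apply, Finset.sum_congr rfl h3,
    Finset.indicator_biUnion_apply F s fun i _ j _ hij => hd hij]

theorem isStarProjection_indicatorOperator (hs : MeasurableSet s) :
    IsStarProjection (indicatorOperator ν s) := by
  refine ⟨by rw [IsIdempotentElem, ← indicatorOperator_inter hs hs, inter_self], ?_⟩
  rw [ContinuousLinearMap.isSelfAdjoint_iff_isSymmetric]
  intro f g
  simp only [ContinuousLinearMap.coe_coe, L2.inner_def]
  refine integral_congr_ae ?_
  filter_upwards [coeFn_indicatorOperator hs f, coeFn_indicatorOperator hs g] with z h1 h2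
  rw [h1, h2]
  by_cases hzs : z ∈ s <;> simp [hzs]

theorem enorm_sq_eq_lintegral (f : Lp ℂ 2 ν) : ‖f‖ₑ ^ 2 = ∫⁻ t, ‖f t‖ₑ ^ 2 ∂ν := by
  rw [Lp.enorm_def, eLpNorm_eq_lintegral_rpow_enorm_toReal (by norm_num) (by norm_num)]
  simp only [ENNReal.toReal_ofNat, ENNReal.rpow_ofNat]
  rw [← ENNReal.rpow_natCast, ← ENNReal.rpow_mul]
  norm_num

theorem enorm_indicatorOperator_sq (hs : MeasurableSet s) (f : Lp ℂ 2 ν) :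
    ‖indicatorOperator ν s f‖ₑ ^ 2 = ν.withDensity (fun t => ‖f t‖ₑ ^ 2) s := by
  rw [enorm_sq_eq_lintegral, withDensity_apply _ hs, ← lintegral_indicator hs]
  refine lintegral_congr_ae ?_
  filter_upwards [coeFn_indicatorOperator hs f] with t ht
  rw [ht]
  by_cases hts : t ∈ s <;> simp [hts]

theorem isFiniteMeasure_withDensity_enorm_sq (f : Lp ℂ 2 ν) :
    IsFiniteMeasure (ν.withDensity (fun t => ‖f t‖ₑ ^ 2)) :=
  isFiniteMeasure_withDensity (by rw [← enorm_sq_eq_lintegral]; finiteness)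

theorem indicatorOperator_eq_zero_iff [SigmaFinite ν] (hs : MeasurableSet s) :
    indicatorOperator ν s = 0 ↔ ν s = 0 := by
  refine ⟨fun h => ?_, fun h => ?_⟩
  · by_contra hpos
    obtain ⟨t, ht, hts, htpos, hfin⟩ :=
      Measure.exists_subset_measure_lt_top hs (pos_iff_ne_zero.2 hpos)
    let f := indicatorConstLp 2 ht hfin.ne (1 : ℂ)
    refine htpos.ne' (measure_eq_zero_iff_ae_notMem.2 ?_)
    filter_upwards [coeFn_indicatorOperator hs f, indicatorConstLp_coeFn_mem (c := (1 : ℂ)),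
      Lp.coeFn_zero ℂ 2 ν] with z hz h1 h0 hzt
    rw [h, zero_apply, h0, indicator_of_mem (hts hzt), h1 hzt] at hz
    exact zero_ne_one hz
  · ext1 f
    refine Lp.ext ?_
    filter_upwards [coeFn_indicatorOperator hs f, measure_eq_zero_iff_ae_notMem.1 h,
      Lp.coeFn_zero ℂ 2 ν] with z hz hzs h0
    rw [hz, indicator_of_notMem hzs]
    exact h0.symm

theorem tendsto_indicatorOperator_zero {ι : Type*} [Preorder ι] [Nonempty ι]
    [(atTop : Filter ι).IsCountablyGenerated] {s : ι → Set α} (hs : ∀ i, MeasurableSet (s i))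
    (hanti : Antitone s) (hinter : ⋂ i, s i = ∅) (f : Lp ℂ 2 ν) :
    Tendsto (fun i => indicatorOperator ν (s i) f) atTop (𝓝 0) := by
  have := isFiniteMeasure_withDensity_enorm_sq f
  have measure_tendsto : Tendsto (fun i => ν.withDensity (fun t => ‖f t‖ₑ ^ 2) (s i)) atTop
      (𝓝 0) := by
    rw [← measure_empty (μ := ν.withDensity (fun t => ‖f t‖ₑ ^ 2)), ← hinter]
    exact tendsto_measure_iInter_atTop (fun i => (hs i).nullMeasurableSet) hanti
      ⟨Classical.arbitrary ι, measure_ne_top _ _⟩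
  have enorm_eq : ∀ i, ‖indicatorOperator ν (s i) f‖ₑ =
      ν.withDensity (fun t => ‖f t‖ₑ ^ 2) (s i) ^ (1 / 2 : ℝ) := fun i => by
    rw [← enorm_indicatorOperator_sq (hs i), ← ENNReal.rpow_natCast, ← ENNReal.rpow_mul]
    norm_num
  rw [tendsto_iff_edist_tendsto_0]
  simp only [edist_zero_right, enorm_eq]
  simpa using measure_tendsto.ennrpow_const (1 / 2 : ℝ)

theorem hasSum_indicatorOperator {s : ℕ → Set α} (hs : ∀ n, MeasurableSet (s n))
    (hd : Pairwise (Function.onFun Disjoint s)) (f : Lp ℂ 2 ν) :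
    HasSum (fun n => indicatorOperator ν (s n) f) (indicatorOperator ν (⋃ n, s n) f) := by
  let rest := fun F : Finset ℕ => (⋃ n, s n) \ ⋃ n ∈ F, s n
  have partial_meas : ∀ F : Finset ℕ, MeasurableSet (⋃ n ∈ F, s n) := fun F =>
    F.measurableSet_biUnion fun n _ => hs n
  have rest_meas : ∀ F, MeasurableSet (rest F) := fun F =>
    (MeasurableSet.iUnion hs).diff (partial_meas F)
  have rest_antitone : Antitone rest := fun F G hFG =>
    sdiff_subset_sdiff_right (biUnion_subset_biUnion_left hFG)
  have iInter_rest : ⋂ F, rest F = ∅ := by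
    refine eq_empty_of_forall_notMem fun z hz => ?_
    rw [mem_iInter] at hz
    obtain ⟨n, hn⟩ := mem_iUnion.1 (hz ∅).1
    exact (hz {n}).2 (by simpa using hn)
  have split : ∀ F : Finset ℕ, ∑ n ∈ F, indicatorOperator ν (s n) f =
      indicatorOperator ν (⋃ n, s n) f - indicatorOperator ν (rest F) f := fun F => by
    rw [← indicatorOperator_biUnion hs hd, eq_sub_iff_add_eq,
      ← indicatorOperator_union (partial_meas F) (rest_meas F) disjoint_sdiff_right,
      union_sdiff_cancel (iUnion₂_subset fun n _ => subset_iUnion s n)]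
  rw [HasSum, SummationFilter.unconditional_filter]
  simp only [split]
  simpa using (tendsto_indicatorOperator_zero rest_meas rest_antitone iInter_rest f).const_sub
    (indicatorOperator ν (⋃ n, s n) f)

end Multiplication

namespace SpectralMeasure

variable {α H : Type*} [MeasurableSpace α] {ν : Measure α} [NormedAddCommGroup H]
  [InnerProductSpace ℂ H] [CompleteSpace H] (W : H ≃ₗᵢ[ℂ] Lp ℂ 2 ν) {m : α → ℂ}

/-- The spectral measure of the operator that a unitary map `W` onto `L²` turns into the
multiplication by `m`. -/
def ofMultiplication (hm : Measurable m) : SpectralMeasure H where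
  proj s := W.symm.toContinuousLinearEquiv.conjContinuousAlgEquiv (indicatorOperator ν (m ⁻¹' s))
  isStarProjection s hs := by
    obtain ⟨idem, symm⟩ := isStarProjection_indicatorOperator (ν := ν) (hm hs)
    refine ⟨idem.map _, ?_⟩
    rw [ContinuousLinearMap.isSelfAdjoint_iff_isSymmetric] at symm ⊢
    intro x y
    simpa [← W.inner_map_map] using symm (W x) (W y)
  proj_univ := by rw [preimage_univ, indicatorOperator_univ, map_one]
  proj_inter s t hs ht := by
    rw [preimage_inter, indicatorOperator_inter (hm hs) (hm ht), map_mul]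
  hasSum_proj s hs hd x := by
    rw [preimage_iUnion]
    exact (hasSum_indicatorOperator (fun n => hm (hs n)) (fun i j hij => (hd hij).preimage m)
      (W x)).mapL (W.symm.toContinuousLinearEquiv : Lp ℂ 2 ν →L[ℂ] H)

variable {W}

theorem ofMultiplication_proj_apply (hm : Measurable m) (s : Set ℂ) (x : H) :
    (ofMultiplication W hm).proj s x = W.symm (indicatorOperator ν (m ⁻¹' s) (W x)) :=
  rfl

theorem scalarMeasure_ofMultiplication (hm : Measurable m) (x : H) :
    (ofMultiplication W hm).scalarMeasure x = (ν.withDensity (fun t => ‖W x t‖ₑ ^ 2)).map m := by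
  ext s hs
  rw [scalarMeasure_apply _ hs, Measure.map_apply hm hs, ← enorm_indicatorOperator_sq (hm hs),
    ofMultiplication_proj_apply, W.symm.enorm_map]

theorem isIntegral_id_ofMultiplication (hm : Measurable m) {A : H →ₗ.[ℂ] H}
    (hd : ∀ x, x ∈ A.domain ↔ MemLp (fun t => m t * W x t) 2 ν)
    (hA : ∀ x : A.domain, W (A x) =ᵐ[ν] fun t => m t * W (x : H) t) :
    (ofMultiplication W hm).IsIntegral id A := by
  have hW : ∀ x, Measurable (fun t => ‖W x t‖ₑ ^ 2) := fun x =>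
    (Lp.stronglyMeasurable (W x)).measurable.enorm.pow_const 2
  refine ⟨fun x => ?_, fun x => ?_⟩
  · have meas : AEStronglyMeasurable (fun t => m t * W x t) ν :=
      hm.aestronglyMeasurable.mul (Lp.aestronglyMeasurable _)
    rw [hd, scalarMeasure_ofMultiplication,
      memLp_map_measure_iff measurable_id.aestronglyMeasurable hm.aemeasurable, Function.id_comp,
      MemLp, MemLp, and_iff_right meas, and_iff_right hm.aestronglyMeasurable,
      eLpNorm_lt_top_iff_lintegral_rpow_enorm_lt_top two_ne_zero ENNReal.ofNat_ne_top,
      eLpNorm_lt_top_iff_lintegral_rpow_enorm_lt_top two_ne_zero ENNReal.ofNat_ne_top]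
    simp only [ENNReal.toReal_ofNat, ENNReal.rpow_ofNat]
    rw [lintegral_withDensity_eq_lintegral_mul _ (hW x) (hm.enorm.pow_const 2)]
    simp only [Pi.mul_apply, enorm_mul, mul_pow, mul_comm]
  · rw [scalarMeasure_ofMultiplication, integral_map hm.aemeasurable
      measurable_id.aestronglyMeasurable, ← W.inner_map_map, L2.inner_def,
      integral_withDensity_eq_integral_toReal_smul (hW _)
        (Eventually.of_forall fun t => ENNReal.pow_lt_top enorm_lt_top)]
    refine integral_congr_ae ?_
    filter_upwards [hA x] with t ht
    rw [ht, RCLike.inner_apply, mul_assoc, RCLike.mul_conj, Complex.real_smul, mul_comm,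
      ENNReal.toReal_pow, toReal_enorm]
    push_cast
    rfl

theorem essentialRange_id_ofMultiplication [TopologicalSpace α] [OpensMeasurableSpace α]
    [ν.IsOpenPosMeasure] [SigmaFinite ν] (hm : Continuous m) :
    (ofMultiplication W hm.measurable).essentialRange id = closure (range m) := by
  ext a
  rw [Metric.mem_closure_range_iff]
  refine forall₂_congr fun ε _ => ?_
  have hopen : IsOpen (m ⁻¹' Metric.ball a ε) := Metric.isOpen_ball.preimage hm
  have proj_eq : (ofMultiplication W hm.measurable).proj (Metric.ball a ε) =
    W.symm.toContinuousLinearEquiv.conjContinuousAlgEquiv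
      (indicatorOperator ν (m ⁻¹' Metric.ball a ε)) := rfl
  rw [preimage_id, proj_eq, ne_eq, EmbeddingLike.map_eq_zero_iff,
    indicatorOperator_eq_zero_iff hopen.measurableSet, hopen.measure_eq_zero_iff ν]
  simp [eq_empty_iff_forall_notMem, dist_comm]

end SpectralMeasure

/-! ### The Fourier transform on `L¹ ∩ L²` -/

section Fourier

open FourierTransform SchwartzMap

variable {V F : Type*} [NormedAddCommGroup V] [InnerProductSpace ℝ V] [FiniteDimensional ℝ V]
  [MeasurableSpace V] [BorelSpace V] [NormedAddCommGroup F] [InnerProductSpace ℂ F]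

theorem continuous_fourier_of_integrable {f : V → F} (hf : Integrable f) : Continuous (𝓕 f) :=
  VectorFourier.fourierIntegral_continuous Real.continuous_fourierChar
    (by simp only [innerₗ_apply_apply]; fun_prop) hf

theorem continuous_fourierInv_of_integrable {f : V → F} (hf : Integrable f) :
    Continuous (𝓕⁻ f) := by
  rw [Real.fourierInv_eq_fourier_comp_neg]
  exact continuous_fourier_of_integrable hf.comp_neg

variable [CompleteSpace F]

theorem ae_eq_of_integral_schwartz_smul_eq {f g : V → F}
    (hf : LocallyIntegrable f) (hg : LocallyIntegrable g)
    (h : ∀ ψ : 𝓢(V, ℂ), ∫ x, ψ x • f x = ∫ x, ψ x • g x) : f =ᵐ[volume] g := by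
  refine ae_eq_of_integral_contDiff_smul_eq hf hg fun ψ hψ hc => ?_
  have hcompact : HasCompactSupport (fun x => (ψ x : ℂ)) :=
    hc.comp_left (g := fun r : ℝ => (r : ℂ)) Complex.ofReal_zero
  have hsmooth : ContDiff ℝ ((⊤ : ℕ∞) : WithTop ℕ∞) (fun x => (ψ x : ℂ)) :=
    Complex.ofRealCLM.contDiff.comp hψ
  simpa [HasCompactSupport.toSchwartzMap_toFun] using h (hcompact.toSchwartzMap hsmooth)

theorem integral_schwartz_fourier_smul_eq (ψ : 𝓢(V, ℂ)) {f : V → F} (hf : Integrable f) :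
    ∫ ξ, 𝓕 ψ ξ • f ξ = ∫ v, ψ v • 𝓕 f v := by
  have h := VectorFourier.integral_fourierIntegral_smul_eq_flip (μ := volume) (ν := volume)
    (L := innerₗ V) Real.continuous_fourierChar (by simp only [innerₗ_apply_apply]; fun_prop)
    (ψ.integrable (μ := volume)) hf
  rwa [flip_innerₗ] at h

theorem integral_schwartz_fourierInv_smul_eq (ψ : 𝓢(V, ℂ)) {f : V → F} (hf : Integrable f) :
    ∫ ξ, 𝓕⁻ ψ ξ • f ξ = ∫ v, ψ v • 𝓕⁻ f v := by
  calc ∫ ξ, 𝓕⁻ ψ ξ • f ξ = ∫ ξ, 𝓕 ψ (-ξ) • f ξ := by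
        simp only [SchwartzMap.fourierInv_coe, SchwartzMap.fourier_coe,
          Real.fourierInv_eq_fourier_neg]
    _ = ∫ ξ, 𝓕 ψ ξ • f (-ξ) := by
        simpa only [neg_neg] using
          (integral_neg_eq_self (fun ξ => 𝓕 ψ (-ξ) • f ξ) volume).symm
    _ = ∫ v, ψ v • 𝓕 (fun ξ => f (-ξ)) v := integral_schwartz_fourier_smul_eq ψ hf.comp_neg
    _ = ∫ v, ψ v • 𝓕⁻ f v := by rw [Real.fourierInv_eq_fourier_comp_neg]

theorem Lp_fourier_ae_eq {f : V → F} (hf : Integrable f) {f₂ : Lp F 2 (volume : Measure V)}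
    (h : f₂ =ᵐ[volume] f) : (𝓕 f₂ : Lp F 2 (volume : Measure V)) =ᵐ[volume] 𝓕 f := by
  refine ae_eq_of_integral_schwartz_smul_eq ((Lp.memLp _).locallyIntegrable one_le_two)
    (continuous_fourier_of_integrable hf).locallyIntegrable fun ψ => ?_
  rw [← integral_schwartz_fourier_smul_eq ψ hf, ← Lp.toTemperedDistribution_apply,
    ← Lp.fourier_toTemperedDistribution_eq, TemperedDistribution.fourier_apply,
    Lp.toTemperedDistribution_apply]
  exact integral_congr_ae (h.mono fun x hx => congrArg (𝓕 ψ x • ·) hx)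

theorem Lp_fourierInv_ae_eq {f : V → F} (hf : Integrable f) {f₂ : Lp F 2 (volume : Measure V)}
    (h : f₂ =ᵐ[volume] f) : (𝓕⁻ f₂ : Lp F 2 (volume : Measure V)) =ᵐ[volume] 𝓕⁻ f := by
  refine ae_eq_of_integral_schwartz_smul_eq ((Lp.memLp _).locallyIntegrable one_le_two)
    (continuous_fourierInv_of_integrable hf).locallyIntegrable fun ψ => ?_
  rw [← integral_schwartz_fourierInv_smul_eq ψ hf, ← Lp.toTemperedDistribution_apply,
    ← Lp.fourierInv_toTemperedDistribution_eq, TemperedDistribution.fourierInv_apply,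
    Lp.toTemperedDistribution_apply]
  exact integral_congr_ae (h.mono fun x hx => congrArg (𝓕⁻ ψ x • ·) hx)

end Fourier

/-! ### Locally absolutely continuous functions -/

theorem absolutelyContinuousOnInterval_integral {u : ℝ → ℝ} (hu : LocallyIntegrable u)
    (c a b : ℝ) : AbsolutelyContinuousOnInterval (fun t => ∫ s in c..t, u s) a b := by
  have hint : IntervalIntegrable u volume (min (min a b) c) (max (max a b) c) :=
    (hu.integrableOn_isCompact isCompact_uIcc).intervalIntegrable
  have hle : min (min a b) c ≤ max (max a b) c := by simp
  refine (hint.absolutelyContinuousOnInterval_intervalIntegral (c := c)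
    (by rw [uIcc_of_le hle]; simp)).mono ?_
  rw [uIcc_of_le hle]
  exact uIcc_subset_Icc ⟨by simp, by simp⟩ ⟨by simp, by simp⟩

namespace LocallyAbsolutelyContinuous

variable {g k : ℝ → ℂ}

theorem of_contDiff (hg : ContDiff ℝ 1 g) : LocallyAbsolutelyContinuous g :=
  fun _ _ => hg.contDiffOn.absolutelyContinuousOnInterval

theorem add (hg : LocallyAbsolutelyContinuous g) (hk : LocallyAbsolutelyContinuous k) :
    LocallyAbsolutelyContinuous (fun t => g t + k t) :=
  fun a b => (hg a b).add (hk a b)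

theorem sub (hg : LocallyAbsolutelyContinuous g) (hk : LocallyAbsolutelyContinuous k) :
    LocallyAbsolutelyContinuous (fun t => g t - k t) :=
  fun a b => (hg a b).sub (hk a b)

theorem mul (hg : LocallyAbsolutelyContinuous g) (hk : LocallyAbsolutelyContinuous k) :
    LocallyAbsolutelyContinuous (fun t => g t * k t) :=
  fun a b => (hg a b).smul (hk a b)

theorem intervalIntegral (hk : LocallyIntegrable k) (c : ℝ) :
    LocallyAbsolutelyContinuous (fun t => ∫ s in c..t, k s) := by
  have hint (t : ℝ) : IntervalIntegrable k volume c t :=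
    (hk.integrableOn_isCompact isCompact_uIcc).intervalIntegrable
  have hre : LocallyIntegrable fun s => (k s).re := fun x => (hk x).imp fun _ h => ⟨h.1, h.2.re⟩
  have him : LocallyIntegrable fun s => (k s).im := fun x => (hk x).imp fun _ h => ⟨h.1, h.2.im⟩
  have hsplit (t : ℝ) : ∫ s in c..t, k s =
      (∫ s in c..t, (k s).re : ℝ) • (1 : ℂ) + (∫ s in c..t, (k s).im : ℝ) • Complex.I := by
    rw [show ∫ s in c..t, (k s).re = (∫ s in c..t, k s).re from
        Complex.reCLM.intervalIntegral_comp_comm (hint t),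
      show ∫ s in c..t, (k s).im = (∫ s in c..t, k s).im from
        Complex.imCLM.intervalIntegral_comp_comm (hint t)]
    simp [Complex.re_add_im]
  intro a b
  simp only [hsplit]
  exact ((absolutelyContinuousOnInterval_integral hre c a b).smul
      (of_contDiff contDiff_const a b)).add
    ((absolutelyContinuousOnInterval_integral him c a b).smul (of_contDiff contDiff_const a b))

theorem exp_mul (a : ℂ) (hg : LocallyAbsolutelyContinuous g) :
    LocallyAbsolutelyContinuous (fun t => Complex.exp (a * t) * g t) :=
  (of_contDiff (contDiff_const.mul Complex.ofRealCLM.contDiff).cexp).mul hg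

end LocallyAbsolutelyContinuous

theorem hasDerivAt_exp_mul {g : ℝ → ℂ} (a : ℂ) {t : ℝ} (hg : DifferentiableAt ℝ g t) :
    HasDerivAt (fun t : ℝ => Complex.exp (a * t) * g t)
      (Complex.exp (a * t) * (deriv g t + a * g t)) t := by
  have hlin : HasDerivAt (fun t : ℝ => a * (t : ℂ)) a t := by
    simpa using (Complex.ofRealCLM.hasDerivAt (x := t)).const_mul a
  exact (hlin.cexp.mul hg.hasDerivAt).congr_deriv (by ring)

namespace LocallyAbsolutelyContinuous

variable {w : ℝ → ℂ}

theorem eq_exp_mul_of_deriv_eq (hw : LocallyAbsolutelyContinuous w) (hd : deriv w =ᵐ[volume] w)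
    (t : ℝ) : w t = Complex.exp t * w 0 := by
  obtain ⟨C, hC⟩ := (hw.exp_mul (-1) 0 t).const_of_ae_hasDerivAt_zero (by
    filter_upwards [hw.ae_differentiableAt, hd] with s hs hds _
    simpa [hds] using hasDerivAt_exp_mul (-1) hs)
  have hconst : Complex.exp (-1 * t) * w t = w 0 := by
    simpa using (hC t right_mem_uIcc).trans (hC 0 left_mem_uIcc).symm
  rw [← hconst, ← mul_assoc, ← Complex.exp_add]
  simp

theorem eq_zero_of_deriv_eq (hw : LocallyAbsolutelyContinuous w) (hd : deriv w =ᵐ[volume] w)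
    (hL : MemLp w 2) : w = 0 := by
  have hexp := hw.eq_exp_mul_of_deriv_eq hd
  have hmem : MemLp (fun _ : ℝ => w 0) 2 (volume.restrict (Ici 0)) := by
    refine (hL.restrict (Ici 0)).of_le aestronglyMeasurable_const ?_
    refine ae_restrict_of_forall_mem measurableSet_Ici fun t ht => ?_
    rw [hexp t, norm_mul, Complex.norm_exp_ofReal]
    exact le_mul_of_one_le_left (norm_nonneg _) (Real.one_le_exp ht)
  have h0 : w 0 = 0 := by
    rw [memLp_const_iff two_ne_zero ENNReal.ofNat_ne_top] at hmem
    simpa using hmem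
  funext t
  rw [hexp t, h0, mul_zero, Pi.zero_apply]

end LocallyAbsolutelyContinuous

/-! ### The derivative on the Fourier side -/

section FourierDerivative

open FourierTransform

/-- The symbol `(2πiξ - 1)⁻¹` of the resolvent `(d/dt - 1)⁻¹` of the derivative. -/
def resolventSymbol (ξ : ℝ) : ℂ := (2 * Real.pi * Complex.I * ξ - 1)⁻¹

theorem normSq_two_pi_I_mul_sub_one (ξ : ℝ) :
    Complex.normSq (2 * Real.pi * Complex.I * ξ - 1) = 1 + (2 * Real.pi * ξ) ^ 2 := by
  simp only [Complex.normSq_apply, Complex.sub_re, Complex.sub_im, Complex.mul_re, Complex.mul_im,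
    Complex.I_re, Complex.I_im, Complex.ofReal_re, Complex.ofReal_im, Complex.re_ofNat,
    Complex.im_ofNat, Complex.one_re, Complex.one_im]
  ring

theorem two_pi_I_mul_sub_one_ne_zero (ξ : ℝ) : (2 * Real.pi * Complex.I * ξ - 1 : ℂ) ≠ 0 := by
  rw [← Complex.normSq_pos, normSq_two_pi_I_mul_sub_one]
  positivity

theorem continuous_resolventSymbol : Continuous resolventSymbol :=
  Continuous.inv₀ (by fun_prop) two_pi_I_mul_sub_one_ne_zero

theorem two_pi_I_mul_resolventSymbol (ξ : ℝ) :
    2 * Real.pi * Complex.I * ξ * resolventSymbol ξ = 1 + resolventSymbol ξ := by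
  have h : (2 * Real.pi * Complex.I * ξ - 1) * resolventSymbol ξ = 1 :=
    mul_inv_cancel₀ (two_pi_I_mul_sub_one_ne_zero ξ)
  linear_combination h

theorem norm_sq_resolventSymbol (ξ : ℝ) :
    ‖resolventSymbol ξ‖ ^ 2 = (1 + (2 * Real.pi * ξ) ^ 2)⁻¹ := by
  rw [resolventSymbol, norm_inv, inv_pow, ← Complex.normSq_eq_norm_sq, normSq_two_pi_I_mul_sub_one]

theorem memLp_two_resolventSymbol : MemLp resolventSymbol 2 := by
  rw [memLp_two_iff_integrable_sq_norm continuous_resolventSymbol.aestronglyMeasurable]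
  simp only [norm_sq_resolventSymbol]
  exact integrable_inv_one_add_sq.comp_mul_left' (by positivity)

theorem norm_resolventSymbol_le_one (ξ : ℝ) : ‖resolventSymbol ξ‖ ≤ 1 := by
  rw [← sq_le_one_iff₀ (norm_nonneg _), norm_sq_resolventSymbol]
  exact inv_le_one_of_one_le₀ (le_add_of_nonneg_right (sq_nonneg _))

theorem conj_fourier_indicator_Ioc_mul {a b : ℝ} (hab : a ≤ b) (ξ : ℝ) :
    (starRingEnd ℂ) (𝓕 ((Ioc a b).indicator (1 : ℝ → ℂ)) ξ) * (2 * Real.pi * Complex.I * ξ) =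
      Complex.exp (2 * Real.pi * Complex.I * ξ * b) -
        Complex.exp (2 * Real.pi * Complex.I * ξ * a) := by
  rcases eq_or_ne ξ 0 with rfl | hξ
  · simp
  have hne : (-(2 * Real.pi * Complex.I * ξ) : ℂ) ≠ 0 := by simp [hξ, Real.pi_ne_zero]
  have hfourier : 𝓕 ((Ioc a b).indicator (1 : ℝ → ℂ)) ξ =
      ∫ v in a..b, Complex.exp (-(2 * Real.pi * Complex.I * ξ) * v) := by
    rw [Real.fourier_real_eq_integral_exp_smul, intervalIntegral.integral_of_le hab,
      ← integral_indicator measurableSet_Ioc]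
    refine integral_congr_ae (Eventually.of_forall fun v => ?_)
    by_cases hv : v ∈ Ioc a b
    · simp only [indicator_of_mem hv, Pi.one_apply, smul_eq_mul, mul_one]
      push_cast
      ring_nf
    · simp only [indicator_of_notMem hv, smul_zero]
  have hconj : (starRingEnd ℂ) (-(2 * Real.pi * Complex.I * ξ)) = 2 * Real.pi * Complex.I * ξ := by
    simp [Complex.conj_ofNat]
  rw [hfourier, integral_exp_mul_complex hne, map_div₀, map_sub, ← Complex.exp_conj,
    ← Complex.exp_conj, map_mul, map_mul, hconj, Complex.conj_ofReal, Complex.conj_ofReal,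
    div_mul_cancel₀ _ (neg_ne_zero.1 hne)]

theorem fourierInv_eq_integral_cexp (h : ℝ → ℂ) (t : ℝ) :
    𝓕⁻ h t = ∫ ξ : ℝ, Complex.exp (2 * Real.pi * Complex.I * ξ * t) * h ξ := by
  rw [Real.fourierInv_eq']
  refine integral_congr_ae (Eventually.of_forall fun ξ => ?_)
  simp only [smul_eq_mul, RCLike.inner_apply, conj_trivial]
  push_cast
  ring_nf

theorem integrable_cexp_mul {h : ℝ → ℂ} (hh : Integrable h) (t : ℝ) :
    Integrable fun ξ : ℝ => Complex.exp (2 * Real.pi * Complex.I * ξ * t) * h ξ := by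
  refine hh.bdd_mul (c := 1) (by fun_prop) (Eventually.of_forall fun ξ => ?_)
  rw [Complex.norm_exp]
  simp

variable {y k : Lp ℂ 2 (volume : Measure ℝ)}

-- Parseval's formula for `k` and the indicator function of `(a, b]`.
theorem intervalIntegral_eq_sub_fourierInv
    (hy : Integrable (𝓕 y : Lp ℂ 2 (volume : Measure ℝ)))
    (hk : (𝓕 k : Lp ℂ 2 (volume : Measure ℝ)) =ᵐ[volume]
      fun ξ => 2 * Real.pi * Complex.I * ξ * (𝓕 y : Lp ℂ 2 (volume : Measure ℝ)) ξ)
    {a b : ℝ} (hab : a ≤ b) :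
    ∫ t in a..b, k t = 𝓕⁻ (⇑(𝓕 y : Lp ℂ 2 (volume : Measure ℝ))) b -
      𝓕⁻ (⇑(𝓕 y : Lp ℂ 2 (volume : Measure ℝ))) a := by
  have hfin : volume (Ioc a b) ≠ ∞ := by simp
  have hind : (𝓕 (indicatorConstLp 2 measurableSet_Ioc hfin (1 : ℂ)) :
      Lp ℂ 2 (volume : Measure ℝ)) =ᵐ[volume] 𝓕 ((Ioc a b).indicator (1 : ℝ → ℂ)) :=
    Lp_fourier_ae_eq ((integrable_indicator_iff measurableSet_Ioc).2 (integrableOn_const hfin))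
      indicatorConstLp_coeFn
  rw [intervalIntegral.integral_of_le hab,
    ← L2.inner_indicatorConstLp_one (𝕜 := ℂ) measurableSet_Ioc hfin k, ← Lp.inner_fourier_eq,
    L2.inner_def, fourierInv_eq_integral_cexp, fourierInv_eq_integral_cexp,
    ← integral_sub (integrable_cexp_mul hy b) (integrable_cexp_mul hy a)]
  refine integral_congr_ae ?_
  filter_upwards [hind, hk] with ξ hindξ hkξ
  rw [hindξ, hkξ, RCLike.inner_apply, ← sub_mul, ← conj_fourier_indicator_Ioc_mul hab ξ]
  ring

theorem fourier_ae_eq_resolventSymbol_mul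
    (hk : (𝓕 k : Lp ℂ 2 (volume : Measure ℝ)) =ᵐ[volume]
      fun ξ => 2 * Real.pi * Complex.I * ξ * (𝓕 y : Lp ℂ 2 (volume : Measure ℝ)) ξ) :
    (𝓕 y : Lp ℂ 2 (volume : Measure ℝ)) =ᵐ[volume]
      fun ξ => resolventSymbol ξ * (𝓕 (k - y) : Lp ℂ 2 (volume : Measure ℝ)) ξ := by
  have hsub : (𝓕 (k - y) : Lp ℂ 2 (volume : Measure ℝ)) = 𝓕 k - 𝓕 y :=
    map_sub (Lp.fourierTransformₗᵢ ℝ ℂ) k y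
  filter_upwards [hk, Lp.coeFn_sub (𝓕 k : Lp ℂ 2 (volume : Measure ℝ)) (𝓕 y)] with ξ hkξ hsubξ
  rw [hsub, hsubξ, Pi.sub_apply, hkξ]
  linear_combination
    -(𝓕 y : Lp ℂ 2 (volume : Measure ℝ)) ξ * two_pi_I_mul_resolventSymbol ξ

theorem integrable_fourier_of_fourier_eq
    (hk : (𝓕 k : Lp ℂ 2 (volume : Measure ℝ)) =ᵐ[volume]
      fun ξ => 2 * Real.pi * Complex.I * ξ * (𝓕 y : Lp ℂ 2 (volume : Measure ℝ)) ξ) :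
    Integrable (𝓕 y : Lp ℂ 2 (volume : Measure ℝ)) :=
  (memLp_two_resolventSymbol.integrable_mul (Lp.memLp _)).congr
    (fourier_ae_eq_resolventSymbol_mul hk).symm

theorem exists_locallyAbsolutelyContinuous_of_fourier_eq
    (hk : (𝓕 k : Lp ℂ 2 (volume : Measure ℝ)) =ᵐ[volume]
      fun ξ => 2 * Real.pi * Complex.I * ξ * (𝓕 y : Lp ℂ 2 (volume : Measure ℝ)) ξ) :
    ∃ g : ℝ → ℂ, LocallyAbsolutelyContinuous g ∧ y =ᵐ[volume] g ∧ k =ᵐ[volume] deriv g := by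
  set h : Lp ℂ 2 (volume : Measure ℝ) := 𝓕 y with hh
  have hint : Integrable h := integrable_fourier_of_fourier_eq hk
  have hloc : LocallyIntegrable k := (Lp.memLp k).locallyIntegrable one_le_two
  have hprimitive : 𝓕⁻ (⇑h) = fun t => 𝓕⁻ (⇑h) 0 + ∫ s in (0 : ℝ)..t, k s := by
    funext t
    rcases le_total 0 t with ht | ht
    · rw [intervalIntegral_eq_sub_fourierInv hint hk ht, add_sub_cancel]
    · rw [intervalIntegral.integral_symm, intervalIntegral_eq_sub_fourierInv hint hk ht, neg_sub,
        add_sub_cancel]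
  refine ⟨𝓕⁻ (⇑h), ?_, ?_, ?_⟩
  · rw [hprimitive]
    exact (LocallyAbsolutelyContinuous.of_contDiff contDiff_const).add
      (LocallyAbsolutelyContinuous.intervalIntegral hloc 0)
  · simpa only [hh, fourierInv_fourier_eq] using Lp_fourierInv_ae_eq hint (ae_eq_refl h)
  · rw [hprimitive]
    filter_upwards [LocallyIntegrable.ae_hasDerivAt_integral hloc] with t ht
    exact ((ht 0).const_add _).deriv.symm

theorem exists_fourier_eq_of_sub_eq (u : Lp ℂ 2 (volume : Measure ℝ)) :
    ∃ y k : Lp ℂ 2 (volume : Measure ℝ), k - y = u ∧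
      (𝓕 k : Lp ℂ 2 (volume : Measure ℝ)) =ᵐ[volume]
        fun ξ => 2 * Real.pi * Complex.I * ξ * (𝓕 y : Lp ℂ 2 (volume : Measure ℝ)) ξ := by
  have hmem : MemLp (fun ξ => resolventSymbol ξ * (𝓕 u : Lp ℂ 2 (volume : Measure ℝ)) ξ) 2 := by
    refine (Lp.memLp (𝓕 u : Lp ℂ 2 (volume : Measure ℝ))).of_le
      (continuous_resolventSymbol.aestronglyMeasurable.mul (Lp.aestronglyMeasurable _))
      (Eventually.of_forall fun ξ => ?_)
    rw [norm_mul]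
    exact mul_le_of_le_one_left (norm_nonneg _) (norm_resolventSymbol_le_one ξ)
  refine ⟨𝓕⁻ (hmem.toLp _), u + 𝓕⁻ (hmem.toLp _), add_sub_cancel_right _ _, ?_⟩
  have hadd : (𝓕 (u + 𝓕⁻ (hmem.toLp _)) : Lp ℂ 2 (volume : Measure ℝ)) =
      𝓕 u + hmem.toLp _ := by
    rw [FourierTransform.fourier_add, fourier_fourierInv_eq]
  rw [hadd, fourier_fourierInv_eq]
  filter_upwards [Lp.coeFn_add (𝓕 u : Lp ℂ 2 (volume : Measure ℝ)) (hmem.toLp _),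
    hmem.coeFn_toLp] with ξ hsum hval
  rw [hsum, Pi.add_apply, hval, ← mul_assoc, two_pi_I_mul_resolventSymbol]
  ring

theorem fourier_eq_of_locallyAbsolutelyContinuous {g : ℝ → ℂ}
    (hg : LocallyAbsolutelyContinuous g) (hy : y =ᵐ[volume] g) (hk : k =ᵐ[volume] deriv g) :
    (𝓕 k : Lp ℂ 2 (volume : Measure ℝ)) =ᵐ[volume]
      fun ξ => 2 * Real.pi * Complex.I * ξ * (𝓕 y : Lp ℂ 2 (volume : Measure ℝ)) ξ := by
  obtain ⟨y', k', hsub, hfourier⟩ := exists_fourier_eq_of_sub_eq (k - y)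
  obtain ⟨g', hg', hy', hk'⟩ := exists_locallyAbsolutelyContinuous_of_fourier_eq hfourier
  have hkk : k - k' = y - y' := sub_eq_sub_iff_sub_eq_sub.1 hsub.symm
  have hval : ⇑(y - y') =ᵐ[volume] fun t => g t - g' t :=
    (Lp.coeFn_sub y y').trans (hy.sub hy')
  have hderiv : deriv (fun t => g t - g' t) =ᵐ[volume] fun t => g t - g' t := by
    filter_upwards [hg.ae_differentiableAt, hg'.ae_differentiableAt, hk, hk', hval,
      Lp.coeFn_sub k k'] with t hgt hgt' hkt hkt' hvalt hsubt
    rw [deriv_fun_sub hgt hgt', ← hkt, ← hkt', ← hvalt, ← hkk, hsubt, Pi.sub_apply]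
  have hzero := (hg.sub hg').eq_zero_of_deriv_eq hderiv ((Lp.memLp (y - y')).ae_eq hval)
  have hyy : y = y' := sub_eq_zero.1 (Lp.ext (hval.trans (hzero ▸ (Lp.coeFn_zero _ _ _).symm)))
  have hkk' : k = k' := by rwa [hyy, sub_self, sub_eq_zero] at hkk
  rwa [hyy, hkk']

theorem fourier_eq_iff_exists_locallyAbsolutelyContinuous :
    (𝓕 k : Lp ℂ 2 (volume : Measure ℝ)) =ᵐ[volume]
        (fun ξ => 2 * Real.pi * Complex.I * ξ * (𝓕 y : Lp ℂ 2 (volume : Measure ℝ)) ξ) ↔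
      ∃ g : ℝ → ℂ, LocallyAbsolutelyContinuous g ∧ y =ᵐ[volume] g ∧ k =ᵐ[volume] deriv g :=
  ⟨exists_locallyAbsolutelyContinuous_of_fourier_eq,
    fun ⟨_, hg, hy, hk⟩ => fourier_eq_of_locallyAbsolutelyContinuous hg hy hk⟩

end FourierDerivative

/-! ### Diagonalization of the momentum operator -/

section Momentum

open FourierTransform

variable {c : ℝ}

theorem ae_weightMeasure : ae (weightMeasure c) = ae (volume : Measure ℝ) :=
  le_antisymm (weightMeasure_absolutelyContinuous c).ae_le
    (absolutelyContinuous_weightMeasure c).ae_le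

theorem eventuallyEq_weightMeasure_iff {f g : ℝ → ℂ} :
    f =ᵐ[weightMeasure c] g ↔ f =ᵐ[volume] g := by
  rw [EventuallyEq, ae_weightMeasure, EventuallyEq]

theorem exp_mul_exp_neg_mul (a z : ℂ) : Complex.exp a * (Complex.exp (-a) * z) = z := by
  rw [← mul_assoc, ← Complex.exp_add, add_neg_cancel, Complex.exp_zero, one_mul]

theorem eLpNorm_weightMeasure (c : ℝ) (f : ℝ → ℂ) :
    eLpNorm f 2 (weightMeasure c) = eLpNorm (fun t : ℝ => Complex.exp (-(c * t)) * f t) 2 := by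
  rw [eLpNorm_eq_lintegral_rpow_enorm_toReal two_ne_zero ENNReal.ofNat_ne_top,
    eLpNorm_eq_lintegral_rpow_enorm_toReal two_ne_zero ENNReal.ofNat_ne_top]
  simp only [ENNReal.toReal_ofNat, ENNReal.rpow_ofNat]
  rw [weightMeasure, lintegral_withDensity_eq_lintegral_mul_non_measurable _ (by fun_prop)
    (Eventually.of_forall fun t => ENNReal.ofReal_lt_top)]
  congr 2
  funext t
  have hweight : ENNReal.ofReal (Real.exp (-2 * c * t)) = ‖Complex.exp (-(c * t))‖ₑ ^ 2 := by
    rw [← ofReal_norm, Complex.norm_exp, ← ENNReal.ofReal_pow (by positivity), ← Real.exp_nat_mul]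
    simp [mul_assoc]
  rw [Pi.mul_apply, hweight, enorm_mul, mul_pow]

theorem memLp_weightMeasure_iff {f : ℝ → ℂ} :
    MemLp f 2 (weightMeasure c) ↔ MemLp (fun t : ℝ => Complex.exp (-(c * t)) * f t) 2 := by
  rw [MemLp, MemLp, eLpNorm_weightMeasure]
  refine and_congr_left fun _ => ⟨fun h => ?_, fun h => ?_⟩
  · exact (Continuous.aestronglyMeasurable (by fun_prop)).mul
      (h.mono_ac (absolutelyContinuous_weightMeasure c))
  · have hmul : AEStronglyMeasurable
        (fun t : ℝ => Complex.exp (c * t) * (Complex.exp (-(c * t)) * f t)) volume :=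
      (Continuous.aestronglyMeasurable (by fun_prop)).mul h
    simp only [exp_mul_exp_neg_mul] at hmul
    exact hmul.mono_ac (weightMeasure_absolutelyContinuous c)

/-- Multiplication by `e^{-ct}`, an isometry of `L²(ℝ, e^{-2ct} dt)` into `L²(ℝ)`. -/
def weightIsometry (c : ℝ) : WeightedSpace c →ₗᵢ[ℂ] Lp ℂ 2 (volume : Measure ℝ) where
  toFun f := (memLp_weightMeasure_iff.1 (Lp.memLp f)).toLp _
  map_add' f g := by
    rw [← MemLp.toLp_add]
    refine MemLp.toLp_congr _ _ ?_
    filter_upwards [eventuallyEq_weightMeasure_iff.1 (Lp.coeFn_add f g)] with t ht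
    simp only [ht, Pi.add_apply, mul_add]
  map_smul' a f := by
    rw [RingHom.id_apply, ← MemLp.toLp_const_smul]
    refine MemLp.toLp_congr _ _ ?_
    filter_upwards [eventuallyEq_weightMeasure_iff.1 (Lp.coeFn_smul a f)] with t ht
    simp only [ht, Pi.smul_apply, smul_eq_mul, mul_left_comm]
  norm_map' f := by
    simp only [LinearMap.coe_mk, AddHom.coe_mk]
    rw [Lp.norm_toLp, ← eLpNorm_weightMeasure, Lp.norm_def]

theorem coeFn_weightIsometry (f : WeightedSpace c) :
    weightIsometry c f =ᵐ[volume] fun t : ℝ => Complex.exp (-(c * t)) * f t :=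
  (memLp_weightMeasure_iff.1 (Lp.memLp f)).coeFn_toLp

theorem weightIsometry_surjective (c : ℝ) : Function.Surjective (weightIsometry c) := by
  intro g
  have hexp (t : ℝ) : Complex.exp (-(c * t)) * (Complex.exp (c * t) * g t) = g t := by
    simpa using exp_mul_exp_neg_mul (-(c * t)) (g t)
  have hmem : MemLp (fun t : ℝ => Complex.exp (c * t) * g t) 2 (weightMeasure c) := by
    rw [memLp_weightMeasure_iff]
    simpa only [hexp] using Lp.memLp g
  refine ⟨hmem.toLp _, Lp.ext ?_⟩
  filter_upwards [coeFn_weightIsometry (hmem.toLp _),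
    eventuallyEq_weightMeasure_iff.1 hmem.coeFn_toLp] with t hweight hval
  rw [hweight, hval, hexp]

theorem mem_shiftGraph_iff {x v : WeightedSpace c} :
    (x, v) ∈ shiftGraph c ↔ ∃ g : ℝ → ℂ, LocallyAbsolutelyContinuous g ∧
      weightIsometry c x =ᵐ[volume] g ∧
      weightIsometry c (v - (c : ℂ) • x) =ᵐ[volume] deriv g := by
  have hsub : ⇑(v - (c : ℂ) • x) =ᵐ[volume] fun t => v t - c * x t := by
    filter_upwards [eventuallyEq_weightMeasure_iff.1 (Lp.coeFn_sub v ((c : ℂ) • x)),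
      eventuallyEq_weightMeasure_iff.1 (Lp.coeFn_smul (c : ℂ) x)] with t hsub hsmul
    rw [hsub, Pi.sub_apply, hsmul, Pi.smul_apply, smul_eq_mul]
  constructor
  · rintro ⟨f, hf, hx, hv⟩
    refine ⟨_, hf.exp_mul (-c), ?_, ?_⟩
    · filter_upwards [coeFn_weightIsometry x, eventuallyEq_weightMeasure_iff.1 hx] with t hWx hx
      rw [hWx, hx, neg_mul]
    · filter_upwards [coeFn_weightIsometry (v - (c : ℂ) • x), hsub, hf.ae_differentiableAt,
        eventuallyEq_weightMeasure_iff.1 hx, eventuallyEq_weightMeasure_iff.1 hv]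
        with t hW hsub hdiff hx hv
      rw [hW, hsub, (hasDerivAt_exp_mul (-c) hdiff).deriv, hx, hv]
      ring_nf
  · rintro ⟨g, hg, hx, hv⟩
    refine ⟨_, hg.exp_mul c, ?_, ?_⟩
    · rw [eventuallyEq_weightMeasure_iff]
      filter_upwards [coeFn_weightIsometry x, hx] with t hWx hx
      rw [← hx, hWx, exp_mul_exp_neg_mul]
    · rw [eventuallyEq_weightMeasure_iff]
      filter_upwards [coeFn_weightIsometry x, coeFn_weightIsometry (v - (c : ℂ) • x), hsub,
        hg.ae_differentiableAt, hx, hv] with t hWx hWv hsub hdiff hx hv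
      rw [(hasDerivAt_exp_mul c hdiff).deriv, ← hx, ← hv, hWx, hWv, hsub, mul_left_comm (c : ℂ),
        ← mul_add, exp_mul_exp_neg_mul, sub_add_cancel]

/-- The unitary map that diagonalizes the momentum operator: multiplication by `e^{-ct}` followed
by the Fourier transform. -/
def momentumUnitary (c : ℝ) : WeightedSpace c ≃ₗᵢ[ℂ] Lp ℂ 2 (volume : Measure ℝ) :=
  (LinearIsometryEquiv.ofSurjective (weightIsometry c) (weightIsometry_surjective c)).trans
    (Lp.fourierTransformₗᵢ ℝ ℂ)

theorem momentumUnitary_apply (x : WeightedSpace c) :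
    momentumUnitary c x = 𝓕 (weightIsometry c x) := rfl

theorem mem_domain_momentumOperator {x : WeightedSpace c} :
    x ∈ (momentumOperator c).domain ↔ x ∈ (infinitesimalShift c).domain := by
  simp [momentumOperator, LinearPMap.sub_domain, scalarOperator]

theorem I_smul_momentumOperator_add_smul {x : WeightedSpace c}
    (hx : x ∈ (infinitesimalShift c).domain) :
    Complex.I • momentumOperator c ⟨x, mem_domain_momentumOperator.2 hx⟩ + (c : ℂ) • x =
      infinitesimalShift c ⟨x, hx⟩ := by
  have hval : momentumOperator c ⟨x, mem_domain_momentumOperator.2 hx⟩ =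
      Complex.I⁻¹ • (infinitesimalShift c ⟨x, hx⟩ - (c : ℂ) • x) := rfl
  rw [hval, smul_inv_smul₀ Complex.I_ne_zero, sub_add_cancel]

theorem mem_graph_momentumOperator_iff_mem_shiftGraph {x u : WeightedSpace c} :
    (x, u) ∈ (momentumOperator c).graph ↔ (x, Complex.I • u + (c : ℂ) • x) ∈ shiftGraph c := by
  rw [← infinitesimalShift_graph, LinearPMap.mem_graph_iff, LinearPMap.mem_graph_iff]
  constructor
  · rintro ⟨⟨_, hx⟩, rfl, rfl⟩
    have hx := mem_domain_momentumOperator.1 hx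
    exact ⟨⟨_, hx⟩, rfl, (I_smul_momentumOperator_add_smul hx).symm⟩
  · rintro ⟨⟨_, hx⟩, rfl, hu⟩
    refine ⟨⟨_, mem_domain_momentumOperator.2 hx⟩, rfl, ?_⟩
    rw [← I_smul_momentumOperator_add_smul hx] at hu
    exact smul_right_injective _ Complex.I_ne_zero (add_right_cancel hu)

theorem mem_graph_momentumOperator_iff {x u : WeightedSpace c} :
    (x, u) ∈ (momentumOperator c).graph ↔
      momentumUnitary c u =ᵐ[volume] fun ξ => 2 * Real.pi * ξ * momentumUnitary c x ξ := by
  rw [mem_graph_momentumOperator_iff_mem_shiftGraph, mem_shiftGraph_iff, add_sub_cancel_right,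
    ← fourier_eq_iff_exists_locallyAbsolutelyContinuous, ← momentumUnitary_apply,
    ← momentumUnitary_apply, map_smul]
  have hsmul := Lp.coeFn_smul Complex.I (momentumUnitary c u)
  refine eventually_congr (hsmul.mono fun ξ hξ => ?_)
  beta_reduce
  rw [hξ, Pi.smul_apply, smul_eq_mul,
    show 2 * Real.pi * Complex.I * ξ * momentumUnitary c x ξ =
      Complex.I * (2 * Real.pi * ξ * momentumUnitary c x ξ) by ring]
  exact mul_right_inj' Complex.I_ne_zero

theorem isIntegral_momentumOperator (c : ℝ) :
    (SpectralMeasure.ofMultiplication (momentumUnitary c)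
      (m := fun ξ : ℝ => (2 * Real.pi * ξ : ℂ)) (by fun_prop)).IsIntegral id
        (momentumOperator c) := by
  have hval (x : (momentumOperator c).domain) :=
    mem_graph_momentumOperator_iff.1 ((momentumOperator c).mem_graph x)
  refine SpectralMeasure.isIntegral_id_ofMultiplication _ (fun x => ⟨fun hx => ?_, fun hx => ?_⟩)
    hval
  · exact (Lp.memLp _).ae_eq (hval ⟨x, hx⟩)
  · refine LinearPMap.mem_domain_of_mem_graph (y := (momentumUnitary c).symm (hx.toLp _)) ?_
    rw [mem_graph_momentumOperator_iff, LinearIsometryEquiv.apply_symm_apply]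
    exact hx.coeFn_toLp

theorem approximatePointSpectrum_momentumOperator (c : ℝ) :
    approximatePointSpectrum (momentumOperator c) = range ((↑) : ℝ → ℂ) := by
  rw [(isIntegral_momentumOperator c).approximatePointSpectrum_eq measurable_id,
    SpectralMeasure.essentialRange_id_ofMultiplication (by fun_prop),
    show (fun ξ : ℝ => (2 * Real.pi * ξ : ℂ)) = (↑) ∘ fun ξ : ℝ => 2 * Real.pi * ξ by
      ext; simp,
    (mul_left_surjective₀ Real.two_pi_pos.ne').range_comp,
    Complex.isUniformEmbedding_ofReal.isClosedEmbedding.isClosed_range.closure_eq]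

end Momentum

/-! ### Truncated spectral operators -/

section Truncation

theorem measurable_riemannZeta : Measurable riemannZeta :=
  measurable_of_continuousOn_compl_singleton 1 fun _ hs =>
    (differentiableAt_riemannZeta hs).continuousAt.continuousWithinAt

theorem tendsto_norm_riemannZeta_atTop : Tendsto (‖riemannZeta ·‖) (𝓝[≠] 1) atTop := by
  have hsub : Tendsto (fun s : ℂ => s - 1) (𝓝[≠] 1) (𝓝[≠] 0) := by
    simpa using ((hasDerivAt_id (1 : ℂ)).sub_const 1).tendsto_nhdsNE one_ne_zero
  have hinv : Tendsto (fun s : ℂ => ‖(s - 1)⁻¹‖) (𝓝[≠] 1) atTop :=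
    tendsto_norm_inv_nhdsNE_zero_atTop.comp hsub
  refine (riemannZeta_residue_one.norm.pos_mul_atTop (by simp) hinv).congr' ?_
  filter_upwards [self_mem_nhdsWithin] with s hs
  rw [← norm_mul, mul_comm, inv_mul_cancel_left₀ (sub_ne_zero.2 hs)]

theorem lowerSemicontinuous_norm_riemannZeta : LowerSemicontinuous (‖riemannZeta ·‖) := by
  intro s
  rcases eq_or_ne s 1 with rfl | hs
  · intro y hy
    rw [← nhdsNE_sup_pure, eventually_sup, eventually_pure]
    exact ⟨tendsto_norm_riemannZeta_atTop.eventually_gt_atTop y, hy⟩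
  · exact (differentiableAt_riemannZeta hs).continuousAt.norm.lowerSemicontinuousAt

theorem zero_notMem_closure_image_riemannZeta {K : Set ℂ} (hK : IsCompact K)
    (h : ∀ s ∈ K, riemannZeta s ≠ 0) : 0 ∉ closure (riemannZeta '' K) := by
  rcases K.eq_empty_or_nonempty with rfl | hne
  · simp
  obtain ⟨a, ha, hmin⟩ :=
    (lowerSemicontinuous_norm_riemannZeta.lowerSemicontinuousOn K).exists_isMinOn hne hK
  rw [Metric.mem_closure_iff]
  push Not
  refine ⟨‖riemannZeta a‖, norm_pos_iff.2 (h a ha), ?_⟩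
  rintro _ ⟨s, hs, rfl⟩
  rw [dist_zero_left]
  exact hmin hs

variable {c : ℝ} {φ : ℝ → ℝ}

theorem exists_isIntegral_truncatedShift (hφ : Continuous φ) :
    ∃ E : SpectralMeasure (WeightedSpace c), E.IsIntegral id (momentumOperator c) ∧
      E.IsIntegral (fun z => c + Complex.I * φ z.re) (truncatedShift c φ) := by
  obtain ⟨E, hV, hB⟩ := isFunctionOf_functionalCalculus (isIntegral_momentumOperator c)
    (f := fun z => (φ z.re : ℂ)) (by fun_prop)
  exact ⟨E, hV, hB.scalarOperator_add_smul c Complex.I_ne_zero⟩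

theorem isFunctionOf_truncatedSpectralOperator (hφ : Continuous φ) :
    IsFunctionOf (truncatedShift c φ) riemannZeta (truncatedSpectralOperator c φ) := by
  obtain ⟨E, -, hE⟩ := exists_isIntegral_truncatedShift (c := c) hφ
  have hF : Measurable fun z : ℂ => (c + Complex.I * φ z.re : ℂ) := by fun_prop
  exact isFunctionOf_functionalCalculus
    ((SpectralMeasure.isIntegral_map_iff measurable_id hF).2 hE) measurable_riemannZeta

theorem approximatePointSpectrum_truncatedShift (hφ : Continuous φ) :
    approximatePointSpectrum (truncatedShift c φ) = {c} ×ℂ closure (range φ) := by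
  obtain ⟨E, hV, hE⟩ := exists_isIntegral_truncatedShift (c := c) hφ
  have hF : Continuous fun z : ℂ => (c + Complex.I * φ z.re : ℂ) := by fun_prop
  have himage : (fun z : ℂ => (c + Complex.I * φ z.re : ℂ)) '' range ((↑) : ℝ → ℂ) =
      {c} ×ℂ range φ := by
    rw [← range_comp]
    ext s
    simp [Complex.mem_reProdIm, Complex.ext_iff, eq_comm]
  rw [hE.approximatePointSpectrum_eq hF.measurable, E.essentialRange_of_continuous hF,
    ← hV.approximatePointSpectrum_eq measurable_id, approximatePointSpectrum_momentumOperator,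
    himage, Complex.closure_reProdIm, closure_singleton]

theorem isInvertibleOperator_truncatedSpectralOperator_iff (hφ : Continuous φ)
    (hcomp : IsCompact (closure (range φ))) :
    IsInvertibleOperator (truncatedSpectralOperator c φ) ↔
      ∀ s ∈ {c} ×ℂ closure (range φ), riemannZeta s ≠ 0 := by
  obtain ⟨E, hA, hB⟩ := isFunctionOf_truncatedSpectralOperator (c := c) hφ
  rw [hB.isInvertibleOperator_iff measurable_riemannZeta,
    ← approximatePointSpectrum_truncatedShift hφ, hA.approximatePointSpectrum_eq measurable_id]
  constructor
  · intro h s hs hzero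
    have hs_ne_one : s ≠ 1 := by
      rintro rfl
      exact riemannZeta_one_ne_zero hzero
    rw [← hzero] at h
    exact h (E.mem_essentialRange_of_continuousAt measurable_riemannZeta hs
      (differentiableAt_riemannZeta hs_ne_one).continuousAt)
  · intro h hzero
    refine zero_notMem_closure_image_riemannZeta ?_ h
      (E.essentialRange_subset_closure_image measurable_riemannZeta hzero)
    rw [← hA.approximatePointSpectrum_eq measurable_id, approximatePointSpectrum_truncatedShift hφ]
    exact isCompact_singleton.reProdIm hcomp

end Truncation

end

theorem theorem5p5_general (c : ℝ) (φ : ℝ → ℝ → ℝ)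
    (hφ : ∀ T : ℝ, 0 < T → IsAdmissibleCutoff c T (φ T)) :
    IsQuasiInvertible c φ ↔ ∀ s : ℂ, s.re = c → riemannZeta s ≠ 0 := by
  have isInvertible_iff (T : ℝ) (hT : 0 < T) :
      IsInvertibleOperator (truncatedSpectralOperator c (φ T)) ↔
        ∀ s ∈ {c} ×ℂ Icc (-T) T, riemannZeta s ≠ 0 := by
    obtain ⟨hcont, hrange, -⟩ := hφ T hT
    rw [isInvertibleOperator_truncatedSpectralOperator_iff hcont (hrange ▸ isCompact_Icc), hrange]
  constructor
  · intro h s hs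
    have hT : 0 < |s.im| + 1 := by positivity
    have hmem : s ∈ {c} ×ℂ Icc (-(|s.im| + 1)) (|s.im| + 1) :=
      ⟨hs, abs_le.1 (le_add_of_nonneg_right zero_le_one)⟩
    exact (isInvertible_iff _ hT).1 (h _ hT) s hmem
  · intro h T hT
    exact (isInvertible_iff T hT).2 fun s hs => h s hs.1

theorem theorem5p5 (c : ℝ) (hc : 0 ≤ c) (φ : ℝ → ℝ → ℝ)
    (hφ : ∀ T : ℝ, 0 < T → IsAdmissibleCutoff c T (φ T)) :
    IsQuasiInvertible c φ ↔ ∀ s : ℂ, s.re = c → riemannZeta s ≠ 0 :=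
  theorem5p5_general c φ hφ
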